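/- An instance $I$ of the GGI Stable Marriage problem (GGISM) consists of $n\ge 1$ men $m_1,\dots,m_n$ and $n$ women $w_1,\dots,w_n$, for each person a strict preference list of all members of the opposite sex, rational weights $\lambda_1\ge\dots\ge\lambda_{2n}\ge 0$, and a strictly increasing disutility function $d:\mathbb N\to\mathbb Q_{\ge 0}$ (given to an algorithm by its values at $1,\dots,n$). A marriage $\mathbf x$ is a perfect matching of men and women; it is stable if no man and woman prefer each other to their partners. The disutility of a person in $\mathbf x$ is $d(r)$, where $r\in\{1,\dots,n\}$ is the rank of the partner in that person's list; $\mathbf d(\mathbf x)\in\mathbb Q^{2n}$ is the vector of the disutilities of all persons, and $\mathrm{GGI}_\lambda(\mathbf d)=\sum_{i=1}^{2n}\lambda_i d^{\downarrow}_i$, where $\mathbf d^{\downarrow}$ is $\mathbf d$ sorted in nonincreasing order. The task is to find a stable marriage $\mathbf x$ that minimizes $\mathrm{GGI}_\lambda(\mathbf d(\mathbf x))$ among all stable marriages. Let $K=|\{i:\lambda_i>0\}|$. For a stable marriage $\mathbf x$, sort the $2n$ triples (disutility of $a$ in $\mathbf x$, $a$, partner of $a$ in $\mathbf x$), $a$ ranging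 over all persons, by nonincreasing disutility, in every possible way when there are ties, and let $T_K^{\downarrow}$ be the set of all vectors formed by the first $K$ triples of such orderings, over all stable marriages $\mathbf x$. Time is counted in elementary operations of a random access machine (uniform cost: memory accesses; additions, subtractions and comparisons of integers; additions, subtractions, multiplications and comparisons of rationals). Then: 1. There is an algorithm that computes, for every instance, an optimal GGI stable marriage in time $O(2^K n^{2K+4})$. 2. There is an algorithm that enumerates, for every instance, the set $T_K^{\downarrow}$ without repetition in time $O(2^K n^{2K+4})$. 3. GGISM is in the class XP for the parameter $K$: there are an algorithm and computable functions $f,g$ such that the algorithm computes, for every instance $I$ of bit length $|I|$, an optimal GGI stable marriage with a number of bit operations (logarithmic cost) at most $f(K)\,|I|^{g(K)}$. The same holds for the decision version, which asks for an instance $I$ and a rational $B$ whether some stable marriage $\mathbf x$ has $\mathrm{GGI}_\lambda(\mathbf d(\mathbf x))\le B$ (the bit length then includes that of $B$). The constants in the $O(\cdot)$ are absolute: they do not depend on $n$, $K$, the preferences, $\lambda$ or $d$. -/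

import Mathlib

/-! ## A random access machine with step counting

The memory consists of arrays of natural numbers and arrays of rational numbers. A program mentions
finitely many arrays, by fixed names; the indices are computed at run time. On naturals (indices)
only addition, truncated subtraction and comparison are available; on rationals addition,
subtraction, multiplication and comparison. Two costs are recorded: the number of elementary
operations (uniform cost) and the number of bits handled (logarithmic cost). -/

namespace RAM

/-- A memory state: `s.N a i` is the `i`-th cell of the `a`-th array of naturals, and
`s.Q a i` the `i`-th cell of the `a`-th array of rationals. -/
structure State where
  N : ℕ → ℕ → ℕ
  Q : ℕ → ℕ → ℚ

/-- `s.setN a i v`: write `v` into cell `i` of the `a`-th array of naturals. -/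
def State.setN (s : State) (a i v : ℕ) : State :=
  { s with N := Function.update s.N a (Function.update (s.N a) i v) }

/-- `s.setQ a i v`: write `v` into cell `i` of the `a`-th array of rationals. -/
def State.setQ (s : State) (a i : ℕ) (v : ℚ) : State :=
  { s with Q := Function.update s.Q a (Function.update (s.Q a) i v) }

/-- Bit length of a rational number (numerator and denominator in lowest terms). -/
def ratSize (q : ℚ) : ℕ := Nat.size q.num.natAbs + Nat.size q.den

/-- Expressions with a natural value; `get a e` reads cell `e` of array `a`. -/
inductive NExp where
  | const (c : ℕ)
  | get (a : ℕ) (e : NExp)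
  | add (e₁ e₂ : NExp)
  | sub (e₁ e₂ : NExp)

/-- Value of an expression. -/
def NExp.eval (s : State) : NExp → ℕ
  | const c => c
  | get a e => s.N a (e.eval s)
  | add e₁ e₂ => e₁.eval s + e₂.eval s
  | sub e₁ e₂ => e₁.eval s - e₂.eval s

/-- Number of elementary operations made to evaluate an expression. -/
def NExp.time : NExp → ℕ
  | const _ => 1
  | get _ e => e.time + 1
  | add e₁ e₂ => e₁.time + e₂.time + 1
  | sub e₁ e₂ => e₁.time + e₂.time + 1

/-- Logarithmic cost of an evaluation: each elementary operation is charged one more than the bit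
length of its result (its operands are charged where they are produced). -/
def NExp.bits (s : State) : NExp → ℕ
  | const c => Nat.size c + 1
  | get a e => e.bits s + Nat.size (s.N a (e.eval s)) + 1
  | add e₁ e₂ => e₁.bits s + e₂.bits s + Nat.size (e₁.eval s + e₂.eval s) + 1
  | sub e₁ e₂ => e₁.bits s + e₂.bits s + Nat.size (e₁.eval s - e₂.eval s) + 1

/-- Expressions with a rational value; `get a e` reads cell `e` of array `a`. -/
inductive QExp where
  | const (c : ℚ)
  | get (a : ℕ) (e : NExp)
  | add (e₁ e₂ : QExp)
  | sub (e₁ e₂ : QExp)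
  | mul (e₁ e₂ : QExp)

/-- Value of an expression. -/
def QExp.eval (s : State) : QExp → ℚ
  | const c => c
  | get a e => s.Q a (e.eval s)
  | add e₁ e₂ => e₁.eval s + e₂.eval s
  | sub e₁ e₂ => e₁.eval s - e₂.eval s
  | mul e₁ e₂ => e₁.eval s * e₂.eval s

/-- Number of elementary operations made to evaluate an expression. -/
def QExp.time : QExp → ℕ
  | const _ => 1
  | get _ e => e.time + 1
  | add e₁ e₂ => e₁.time + e₂.time + 1
  | sub e₁ e₂ => e₁.time + e₂.time + 1
  | mul e₁ e₂ => e₁.time + e₂.time + 1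

/-- Logarithmic cost of an evaluation. -/
def QExp.bits (s : State) : QExp → ℕ
  | const c => ratSize c + 1
  | get a e => e.bits s + ratSize (s.Q a (e.eval s)) + 1
  | add e₁ e₂ => e₁.bits s + e₂.bits s + ratSize (e₁.eval s + e₂.eval s) + 1
  | sub e₁ e₂ => e₁.bits s + e₂.bits s + ratSize (e₁.eval s - e₂.eval s) + 1
  | mul e₁ e₂ => e₁.bits s + e₂.bits s + ratSize (e₁.eval s * e₂.eval s) + 1

/-- Tests. -/
inductive BExp where
  | leN (e₁ e₂ : NExp)
  | leQ (e₁ e₂ : QExp)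
  | not (b : BExp)
  | and (b₁ b₂ : BExp)

/-- Truth value of a test. -/
def BExp.eval (s : State) : BExp → Bool
  | leN e₁ e₂ => decide (e₁.eval s ≤ e₂.eval s)
  | leQ e₁ e₂ => decide (e₁.eval s ≤ e₂.eval s)
  | not b => !b.eval s
  | and b₁ b₂ => b₁.eval s && b₂.eval s

/-- Number of elementary operations made to evaluate a test. -/
def BExp.time : BExp → ℕ
  | leN e₁ e₂ => e₁.time + e₂.time + 1
  | leQ e₁ e₂ => e₁.time + e₂.time + 1
  | not b => b.time + 1
  | and b₁ b₂ => b₁.time + b₂.time + 1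

/-- Logarithmic cost of a test. -/
def BExp.bits (s : State) : BExp → ℕ
  | leN e₁ e₂ => e₁.bits s + e₂.bits s + 1
  | leQ e₁ e₂ => e₁.bits s + e₂.bits s + 1
  | not b => b.bits s + 1
  | and b₁ b₂ => b₁.bits s + b₂.bits s + 1

/-- Programs. `setN a e v` writes the value of `v` into cell `e` of the `a`-th array. -/
inductive Prog where
  | skip
  | setN (a : ℕ) (e v : NExp)
  | setQ (a : ℕ) (e : NExp) (v : QExp)
  | seq (p q : Prog)
  | ite (c : BExp) (p q : Prog)
  | while (c : BExp) (p : Prog)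

/-- `Exec p s s' t b`: started in `s`, the program `p` halts in `s'` after `t` elementary
operations (uniform cost), with logarithmic cost `b`. -/
inductive Exec : Prog → State → State → ℕ → ℕ → Prop where
  | skip (s : State) : Exec .skip s s 1 1
  | setN (a : ℕ) (e v : NExp) (s : State) :
      Exec (.setN a e v) s (s.setN a (e.eval s) (v.eval s))
        (e.time + v.time + 1) (e.bits s + v.bits s + 1)
  | setQ (a : ℕ) (e : NExp) (v : QExp) (s : State) :
      Exec (.setQ a e v) s (s.setQ a (e.eval s) (v.eval s))
        (e.time + v.time + 1) (e.bits s + v.bits s + 1)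
  | seq {p q : Prog} {s₁ s₂ s₃ : State} {t₁ b₁ t₂ b₂ : ℕ}
      (h₁ : Exec p s₁ s₂ t₁ b₁) (h₂ : Exec q s₂ s₃ t₂ b₂) :
      Exec (.seq p q) s₁ s₃ (t₁ + t₂) (b₁ + b₂)
  | ite_true {c : BExp} {p q : Prog} {s s' : State} {t b : ℕ}
      (hc : c.eval s = true) (h : Exec p s s' t b) :
      Exec (.ite c p q) s s' (c.time + t + 1) (c.bits s + b + 1)
  | ite_false {c : BExp} {p q : Prog} {s s' : State} {t b : ℕ}
      (hc : c.eval s = false) (h : Exec q s s' t b) :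
      Exec (.ite c p q) s s' (c.time + t + 1) (c.bits s + b + 1)
  | while_false {c : BExp} {p : Prog} {s : State} (hc : c.eval s = false) :
      Exec (.while c p) s s (c.time + 1) (c.bits s + 1)
  | while_true {c : BExp} {p : Prog} {s₁ s₂ s₃ : State} {t₁ b₁ t₂ b₂ : ℕ}
      (hc : c.eval s₁ = true) (h₁ : Exec p s₁ s₂ t₁ b₁)
      (h₂ : Exec (.while c p) s₂ s₃ t₂ b₂) :
      Exec (.while c p) s₁ s₃ (c.time + t₁ + t₂ + 1) (c.bits s₁ + b₁ + b₂ + 1)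

/-- An input: finitely many finite arrays of naturals and of rationals. -/
structure Input where
  nats : List (List ℕ)
  rats : List (List ℚ)

/-- The initial memory for an input; all cells that hold no input are `0`. -/
def Input.state (x : Input) : State where
  N a i := (x.nats.getD a []).getD i 0
  Q a i := (x.rats.getD a []).getD i 0

/-- Length of an input in bits. -/
def Input.size (x : Input) : ℕ :=
  (x.nats.map fun l => (l.map fun v => Nat.size v + 1).sum).sum +
    (x.rats.map fun l => (l.map fun q => ratSize q + 1).sum).sum

/-- A parameterized computational problem: instances, their encoding, the parameter, and the
requirement on the memory at the end of a computation (the output is correct). -/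
structure ParamProblem where
  Inst : Type
  encode : Inst → Input
  param : Inst → ℕ
  Correct : Inst → State → Prop

/-- The problem is solved by a program in `O(T)` elementary operations; the program and the
constant are the same for all instances. -/
def ParamProblem.SolvableInTime (p : ParamProblem) (T : p.Inst → ℕ) : Prop :=
  ∃ (P : Prog) (C : ℕ), ∀ I : p.Inst, ∃ (s : State) (t b : ℕ),
    Exec P (p.encode I).state s t b ∧ p.Correct I s ∧ t ≤ C * T I

/-- The class XP: some program solves the problem on every instance `I` with parameter `k` in bit
time `f k * |I| ^ g k`, where `f` and `g` are computable and `|I|` is the length of `I` in bits. The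
logarithmic cost of this machine and Turing machine time are polynomially related. -/
def ParamProblem.InXP (p : ParamProblem) : Prop :=
  ∃ (P : Prog) (f g : ℕ → ℕ), Computable f ∧ Computable g ∧
    ∀ I : p.Inst, ∃ (s : State) (t b : ℕ),
      Exec P (p.encode I).state s t b ∧ p.Correct I s ∧
        b ≤ f (p.param I) * (p.encode I).size ^ g (p.param I)

end RAM

/-! ## The GGI stable marriage problem -/

namespace GGISM

/-- An instance: `n ≥ 1` men and `n` women (indexed by `Fin n`), complete strict preference lists,
nonincreasing nonnegative weights `λ₁, …, λ_{2n}`, and a strictly increasing disutility function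
of the ranks `1, 2, …`. `menList i k` is the woman in position `k` (counted from `0`) of the list of
man `i`, and symmetrically for `womenList`. -/
structure Instance where
  n : ℕ
  n_pos : 0 < n
  menList : Fin n → Equiv.Perm (Fin n)
  womenList : Fin n → Equiv.Perm (Fin n)
  weight : Fin (n + n) → ℚ≥0
  weight_antitone : Antitone weight
  disutility : ℕ → ℚ≥0
  disutility_strictMono : StrictMono disutility

namespace Instance

variable (I : Instance)

/-- Rank (from `1` to `n`) of woman `j` in the list of man `i`. -/
def rkM (i j : Fin I.n) : ℕ := ((I.menList i).symm j : ℕ) + 1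

/-- Rank (from `1` to `n`) of man `i` in the list of woman `j`. -/
def rkW (j i : Fin I.n) : ℕ := ((I.womenList j).symm i : ℕ) + 1

/-- A marriage is a perfect matching, given as the bijection from men to women. -/
abbrev Marriage : Type := Equiv.Perm (Fin I.n)

/-- A marriage is stable if no man and woman prefer each other to their partners. -/
def IsStable (x : I.Marriage) : Prop :=
  ∀ i j : Fin I.n, ¬ (I.rkM i j < I.rkM i (x i) ∧ I.rkW j i < I.rkW j (x.symm j))

/-- The vector `(d(m₁,x), …, d(mₙ,x), d(w₁,x), …, d(wₙ,x))` of disutilities. Agents are numbered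
from `0` to `2n - 1`, first the men and then the women. -/
def disVec (x : I.Marriage) : Fin (I.n + I.n) → ℚ :=
  Fin.append (fun i => (I.disutility (I.rkM i (x i)) : ℚ))
    (fun j => (I.disutility (I.rkW j (x.symm j)) : ℚ))

/-- The partner of an agent. -/
def partner (x : I.Marriage) : Fin (I.n + I.n) → Fin (I.n + I.n) :=
  Fin.append (fun i => Fin.natAdd I.n (x i)) (fun j => Fin.castAdd I.n (x.symm j))

end Instance

/-- Generalized Gini index: `∑ i, lam i * v↓ i`, where `v↓` is `v` sorted in nonincreasing order
(`Tuple.sort` sorts in nondecreasing order, hence the reversal). -/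
def ggi {N : ℕ} (lam v : Fin N → ℚ) : ℚ := ∑ i, lam i * v (Tuple.sort v i.rev)

namespace Instance

variable (I : Instance)

/-- GGI value of a marriage. -/
def value (x : I.Marriage) : ℚ := ggi (fun i => (I.weight i : ℚ)) (I.disVec x)

/-- `x` is an optimal GGI stable marriage. -/
def IsOptimal (x : I.Marriage) : Prop :=
  I.IsStable x ∧ ∀ y : I.Marriage, I.IsStable y → I.value x ≤ I.value y

/-- The number of positive weights. -/
def K : ℕ := (Finset.univ.filter fun i => 0 < I.weight i).card

/-- The triple (disutility, agent, partner) of an agent. -/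
def triple (x : I.Marriage) (a : Fin (I.n + I.n)) : ℚ × Fin (I.n + I.n) × Fin (I.n + I.n) :=
  (I.disVec x a, a, I.partner x a)

/-- All vectors formed by the first `k` components of the triples of a stable marriage, sorted by
nonincreasing disutility (in every possible way when there are ties). -/
def topPrefixes (k : ℕ) : Set (List (ℚ × Fin (I.n + I.n) × Fin (I.n + I.n))) :=
  {v | ∃ (x : I.Marriage) (σ : Equiv.Perm (Fin (I.n + I.n))), I.IsStable x ∧
    Antitone (I.disVec x ∘ σ) ∧ v = (List.ofFn (I.triple x ∘ σ)).take k}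

/-- The input: arrays of naturals `0`: the number `n`; `1`, `2`: the preference lists of the men and
of the women, one list after the other; arrays of rationals `0`: the disutilities of the ranks
`1, …, n`; `1`: the weights; further arrays in `extra`. -/
def encode (extra : List (List ℚ)) : RAM.Input where
  nats := [[I.n],
    List.ofFn fun t : Fin (I.n * I.n) => (I.menList t.divNat t.modNat : ℕ),
    List.ofFn fun t : Fin (I.n * I.n) => (I.womenList t.divNat t.modNat : ℕ)]
  rats := (List.ofFn fun k : Fin I.n => (I.disutility ((k : ℕ) + 1) : ℚ)) ::
    (List.ofFn fun i => (I.weight i : ℚ)) :: extra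

end Instance

/-- GGISM: compute an optimal GGI stable marriage. At the end, cell `i` of the array `3` of naturals
holds the partner of man `i`. -/
def optimization : RAM.ParamProblem where
  Inst := Instance
  encode I := I.encode []
  param I := I.K
  Correct I s := ∃ x : I.Marriage, I.IsOptimal x ∧ ∀ i : Fin I.n, s.N 3 i = (x i : ℕ)

/-- Decision version of GGISM: is there a stable marriage whose GGI value is at most a given
rational? The answer `1` (yes) or `0` (no) is left in cell `0` of the array `7` of naturals. -/
def decision : RAM.ParamProblem where
  Inst := Instance × ℚ
  encode J := J.1.encode [[J.2]]
  param J := J.1.K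
  Correct J s :=
    ((∃ x : J.1.Marriage, J.1.IsStable x ∧ J.1.value x ≤ J.2) → s.N 7 0 = 1) ∧
    ((¬ ∃ x : J.1.Marriage, J.1.IsStable x ∧ J.1.value x ≤ J.2) → s.N 7 0 = 0)

/-- Enumerate, without repetition, the vectors of the `K` top triples. At the end, the number of
vectors is in cell `0` of the array `4` of naturals; component `p` of vector `j` is in the cells
`j * K + p` of the array `3` of rationals (disutility) and of the arrays `5` and `6` of naturals
(agent and partner). -/
def enumeration : RAM.ParamProblem where
  Inst := Instance
  encode I := I.encode []
  param I := I.K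
  Correct I s := ∃ V : List (List (ℚ × Fin (I.n + I.n) × Fin (I.n + I.n))),
    V.Nodup ∧ (∀ v, v ∈ V ↔ v ∈ I.topPrefixes I.K) ∧ s.N 4 0 = V.length ∧
    ∀ j v, V[j]? = some v → ∀ p τ, v[p]? = some τ →
      s.Q 3 (j * I.K + p) = τ.1 ∧ s.N 5 (j * I.K + p) = (τ.2.1 : ℕ) ∧
        s.N 6 (j * I.K + p) = (τ.2.2 : ℕ)

end GGISM

/-! ## A program logic with time bounds -/

/-! Since the weights are nonincreasing, exactly the first `K` are positive, so the index of a
marriage depends only on its `K` largest disutilities. Disutility is strictly increasing in the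
rank, so these are encoded by a word of `K` pairs (agent, position in the agent's list). There are
`(2n * n) ^ K = 2 ^ K * n ^ (2K)` words. The algorithm runs through all of them and decides in `O(n
^ 4)` operations whether a word comes from a stable marriage.

For a word with distinct agents and nonincreasing ranks, being the top of a marriage is a condition
on single pairs: each listed agent gets exactly the prescribed rank, and every other agent a rank at
most the last one (`Bounds.isTop_iff`). It remains to find a stable marriage that consists of
allowed pairs, where forbidden pairs may still block. Gale–Shapley does this when a woman also
rejects men who are not allowed to her and remembers all proposals ever made: no man passes his
partner in any admissible stable marriage (`Safe.update`), and when nobody is rejected, either the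
current proposals form such a marriage (`exists_stable_of_forall_not_rejects`) or some man has
exhausted his list and there is none. All marriages with the same top word have the same value
(`value_eq_of_isTop`), so one marriage per word suffices; `exists_isStable` guarantees that at least
one word succeeds.

Running times are proved in a small Hoare logic (`Runs`) with a frame rule. For XP, the only
products of rationals are weight times disutility, both input cells. Hence all rationals in memory
share one denominator of polynomial length, numerators grow by at most one bit per operation, and
the logarithmic cost is at most quadratic in the uniform cost and the input length
(`Exec.bits_le_of_input`). -/

namespace RAM

namespace State

variable (s : State) (a i b : ℕ)

@[simp] theorem setN_N (v : ℕ) :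
    (s.setN a i v).N b = if b = a then Function.update (s.N a) i v else s.N b := by
  simp only [setN, Function.update_apply]

@[simp] theorem setN_Q (v : ℕ) : (s.setN a i v).Q b = s.Q b := rfl

@[simp] theorem setQ_N (v : ℚ) : (s.setQ a i v).N b = s.N b := rfl

@[simp] theorem setQ_Q (v : ℚ) :
    (s.setQ a i v).Q b = if b = a then Function.update (s.Q a) i v else s.Q b := by
  simp only [setQ, Function.update_apply]

end State

/-- The variable held in cell `0` of an array. -/
def NExp.var (a : ℕ) : NExp := .get a (.const 0)

/-- Strict comparison of naturals. -/
def BExp.ltN (e₁ e₂ : NExp) : BExp := .not (.leN e₂ e₁)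

@[simp] theorem NExp.eval_var (s : State) (a : ℕ) : (NExp.var a).eval s = s.N a 0 := rfl

namespace BExp

variable (s : State)

@[simp] theorem leN_iff (e₁ e₂ : NExp) :
    (leN e₁ e₂).eval s = true ↔ e₁.eval s ≤ e₂.eval s := by simp [eval]

@[simp] theorem leQ_iff (e₁ e₂ : QExp) :
    (leQ e₁ e₂).eval s = true ↔ e₁.eval s ≤ e₂.eval s := by simp [eval]

@[simp] theorem ltN_iff (e₁ e₂ : NExp) :
    (ltN e₁ e₂).eval s = true ↔ e₁.eval s < e₂.eval s := by simp [ltN, eval]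

@[simp] theorem and_iff (b₁ b₂ : BExp) :
    (and b₁ b₂).eval s = true ↔ b₁.eval s = true ∧ b₂.eval s = true := by simp [eval]

end BExp

namespace Prog

/-- Does a program mention a write to the `a`-th array of naturals? -/
def writesN : Prog → ℕ → Bool
  | setN a _ _, b => decide (b = a)
  | seq p q, b => p.writesN b || q.writesN b
  | ite _ p q, b => p.writesN b || q.writesN b
  | .while _ p, b => p.writesN b
  | _, _ => false

/-- Does a program mention a write to the `a`-th array of rationals? -/
def writesQ : Prog → ℕ → Bool
  | setQ a _ _, b => decide (b = a)
  | seq p q, b => p.writesQ b || q.writesQ b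
  | ite _ p q, b => p.writesQ b || q.writesQ b
  | .while _ p, b => p.writesQ b
  | _, _ => false

/-- Programs without loops. -/
def loopFree : Prog → Bool
  | seq p q => p.loopFree && q.loopFree
  | ite _ p q => p.loopFree && q.loopFree
  | .while _ _ => false
  | _ => true

/-- Final memory of a program without loops. -/
def sem : Prog → State → State
  | setN a e v, s => s.setN a (e.eval s) (v.eval s)
  | setQ a e v, s => s.setQ a (e.eval s) (v.eval s)
  | seq p q, s => q.sem (p.sem s)
  | ite c p q, s => if c.eval s = true then p.sem s else q.sem s
  | _, s => s

/-- Maximal number of elementary operations of a program without loops. -/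
def cost : Prog → ℕ
  | skip => 1
  | setN _ e v => e.time + v.time + 1
  | setQ _ e v => e.time + v.time + 1
  | seq p q => p.cost + q.cost
  | ite c p q => c.time + max p.cost q.cost + 1
  | .while _ _ => 0

/-- `for v in 0, …, b[0] - 1 do p`, the counter being kept in cell `0` of the array `v`. -/
def loop (v b : ℕ) (p : Prog) : Prog :=
  seq (setN v (.const 0) (.const 0))
    (.while (.ltN (.var v) (.var b)) (seq p (setN v (.const 0) (.add (.var v) (.const 1)))))

end Prog

/-- The arrays that the program does not mention in a write are unchanged. -/
def Keeps (p : Prog) (s s' : State) : Prop :=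
  (∀ a, p.writesN a = false → s'.N a = s.N a) ∧ ∀ a, p.writesQ a = false → s'.Q a = s.Q a

theorem Keeps.refl (p : Prog) (s : State) : Keeps p s s := ⟨fun _ _ => rfl, fun _ _ => rfl⟩

theorem Keeps.trans {p : Prog} {s₁ s₂ s₃ : State} (h₁ : Keeps p s₁ s₂) (h₂ : Keeps p s₂ s₃) :
    Keeps p s₁ s₃ :=
  ⟨fun a ha => (h₂.1 a ha).trans (h₁.1 a ha), fun a ha => (h₂.2 a ha).trans (h₁.2 a ha)⟩

theorem Keeps.mono {p q : Prog} {s s' : State} (h : Keeps p s s')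
    (hN : ∀ a, q.writesN a = false → p.writesN a = false)
    (hQ : ∀ a, q.writesQ a = false → p.writesQ a = false) : Keeps q s s' :=
  ⟨fun a ha => h.1 a (hN a ha), fun a ha => h.2 a (hQ a ha)⟩

/-- The frame rule. Array names are fixed in the program text, so for a concrete program `decide`
settles which arrays survive, whatever indices are computed. -/
theorem Exec.keeps {p : Prog} {s s' : State} {t b : ℕ} (h : Exec p s s' t b) : Keeps p s s' := by
  induction h with
  | skip s => exact .refl _ _
  | setN a e v s => exact ⟨fun b hb => by simp_all [Prog.writesN], fun b _ => rfl⟩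
  | setQ a e v s => exact ⟨fun b _ => rfl, fun b hb => by simp_all [Prog.writesQ]⟩
  | seq h₁ h₂ ih₁ ih₂ =>
    exact (ih₁.mono (by simp_all [Prog.writesN]) (by simp_all [Prog.writesQ])).trans
      (ih₂.mono (by simp_all [Prog.writesN]) (by simp_all [Prog.writesQ]))
  | ite_true hc h ih =>
    exact ih.mono (by simp_all [Prog.writesN]) (by simp_all [Prog.writesQ])
  | ite_false hc h ih =>
    exact ih.mono (by simp_all [Prog.writesN]) (by simp_all [Prog.writesQ])
  | while_false hc => exact .refl _ _
  | while_true hc h₁ h₂ ih₁ ih₂ =>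
    exact (ih₁.mono (by simp_all [Prog.writesN]) (by simp_all [Prog.writesQ])).trans ih₂

/-- Started in `s`, the program halts after at most `T` elementary operations, in a state that
satisfies `Q`. -/
def Runs (p : Prog) (s : State) (T : ℕ) (Q : State → Prop) : Prop :=
  ∃ s' t b, Exec p s s' t b ∧ t ≤ T ∧ Q s'

namespace Runs

variable {p q : Prog} {s : State} {T T₁ T₂ : ℕ} {Q R : State → Prop}

theorem mono (h : Runs p s T₁ R) (hT : T₁ ≤ T₂) (hQ : ∀ s', Keeps p s s' → R s' → Q s') :
    Runs p s T₂ Q := by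
  obtain ⟨s', t, b, he, ht, hR⟩ := h
  exact ⟨s', t, b, he, ht.trans hT, hQ s' he.keeps hR⟩

theorem imp (h : Runs p s T R) (hQ : ∀ s', Keeps p s s' → R s' → Q s') : Runs p s T Q :=
  h.mono le_rfl hQ

theorem le (h : Runs p s T₁ Q) (hT : T₁ ≤ T₂) : Runs p s T₂ Q := h.mono hT fun _ _ h => h

theorem seq (h₁ : Runs p s T₁ R) (h₂ : ∀ s', Keeps p s s' → R s' → Runs q s' T₂ Q) :
    Runs (.seq p q) s (T₁ + T₂) Q := by
  obtain ⟨s₁, t₁, b₁, he₁, ht₁, hR⟩ := h₁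
  obtain ⟨s₂, t₂, b₂, he₂, ht₂, hQ⟩ := h₂ s₁ he₁.keeps hR
  exact ⟨s₂, _, _, .seq he₁ he₂, Nat.add_le_add ht₁ ht₂, hQ⟩

theorem ite {c : BExp} (h₁ : c.eval s = true → Runs p s T Q)
    (h₂ : ¬ c.eval s = true → Runs q s T Q) : Runs (.ite c p q) s (c.time + T + 1) Q := by
  by_cases hc : c.eval s = true
  · obtain ⟨s', t, b, he, ht, hQ⟩ := h₁ hc
    exact ⟨s', _, _, .ite_true hc he, by omega, hQ⟩
  · obtain ⟨s', t, b, he, ht, hQ⟩ := h₂ hc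
    exact ⟨s', _, _, .ite_false (Bool.eq_false_iff.2 hc) he, by omega, hQ⟩

theorem loopFree (hp : p.loopFree = true) (s : State) : Runs p s p.cost (· = p.sem s) := by
  induction p generalizing s with
  | skip => exact ⟨_, _, _, .skip s, le_rfl, rfl⟩
  | setN a e v => exact ⟨_, _, _, .setN a e v s, le_rfl, rfl⟩
  | setQ a e v => exact ⟨_, _, _, .setQ a e v s, le_rfl, rfl⟩
  | seq p q ihp ihq =>
    simp only [Prog.loopFree, Bool.and_eq_true] at hp
    exact (ihp hp.1 s).seq fun s' _ hs' => by subst hs'; exact ihq hp.2 _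
  | ite c p q ihp ihq =>
    simp only [Prog.loopFree, Bool.and_eq_true] at hp
    refine Runs.ite (T := max p.cost q.cost) (fun hc => ?_) fun hc => ?_
    · exact (ihp hp.1 s).mono (le_max_left _ _) fun s' _ h => by simp [h, Prog.sem, hc]
    · exact (ihq hp.2 s).mono (le_max_right _ _) fun s' _ h => by simp [h, Prog.sem, hc]
  | _ => simp [Prog.loopFree] at hp

/-- Symbolic execution of a block without loops: only the postcondition needs thought, the side
conditions are computations. -/
theorem of_sem (T : ℕ) (hQ : Q (p.sem s)) (hp : p.loopFree = true := by decide)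
    (hT : p.cost ≤ T := by decide) : Runs p s T Q :=
  (loopFree hp s).mono hT fun s' _ h => by rw [h]; exact hQ

/-- The index of the invariant is the variant: it drops in every iteration, so it bounds their
number. It may drop by more than one, which allows a loop to stop early. -/
theorem whileLoop {c : BExp} (Inv : ℕ → State → Prop)
    (step : ∀ k s, Inv k s → (¬ c.eval s = true ∧ Q s) ∨
      (c.eval s = true ∧ Runs p s T fun s' => ∃ k' < k, Inv k' s')) (k : ℕ) (s : State)
    (h : Inv k s) : Runs (.while c p) s (k * (c.time + T + 1) + (c.time + 1)) Q := by
  induction k using Nat.strong_induction_on generalizing s with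
  | _ k ih =>
    obtain ⟨hc, hQ⟩ | ⟨hc, s₁, t₁, b₁, he₁, ht₁, k', hk', hI⟩ := step k s h
    · exact ⟨s, _, _, .while_false (Bool.eq_false_iff.2 hc), by omega, hQ⟩
    · obtain ⟨s₂, t₂, b₂, he₂, ht₂, hQ⟩ := ih k' hk' s₁ hI
      refine ⟨s₂, _, _, .while_true hc he₁ he₂, ?_, hQ⟩
      have : (k' + 1) * (c.time + T + 1) ≤ k * (c.time + T + 1) := Nat.mul_le_mul_right _ hk'
      rw [Nat.add_mul] at this
      omega

/-- The invariant of a counting loop must not depend on the counter. -/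
theorem loop {v b m : ℕ} {Inv : ℕ → State → Prop} (hm : s.N b 0 = m)
    (hInv : ∀ i s x, Inv i s → Inv i (s.setN v 0 x)) (h0 : Inv 0 s)
    (step : ∀ i < m, ∀ s', Keeps (.loop v b p) s s' → s'.N v 0 = i → Inv i s' →
      Runs p s' T (Inv (i + 1)))
    (hv : p.writesN v = false := by decide) (hb : (Prog.loop v b p).writesN b = false := by decide) :
    Runs (.loop v b p) s (m * (T + 13) + 10) (Inv m) := by
  have hbv : b ≠ v := by rintro rfl; simp [Prog.loop, Prog.writesN] at hb
  -- Incrementing the counter costs 6 and the test 6, so an iteration takes `T + 13`; the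
  -- initialisation costs 3 and the last test 7. The variant is `m - i`.
  have key := Runs.whileLoop (c := .ltN (.var v) (.var b)) (Q := Inv m) (T := T + 6)
    (p := .seq p (.setN v (.const 0) (.add (.var v) (.const 1))))
    (fun k s' => ∃ i, i + k = m ∧ Keeps (.loop v b p) s s' ∧ s'.N v 0 = i ∧ Inv i s') ?_ m
    (s.setN v 0 0) ⟨0, by simp, ?_, by simp, hInv _ _ _ h0⟩
  · obtain ⟨s', t, b', he, ht, hQ⟩ := key
    refine ⟨s', _, _, .seq (.setN v (.const 0) (.const 0) s) he, ?_, hQ⟩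
    have e : (BExp.ltN (.var v) (.var b)).time = 6 := rfl
    simp only [NExp.time, e] at *
    rw [show 6 + (T + 6) + 1 = T + 13 by omega] at ht
    omega
  · rintro k s' ⟨i, hik, hs, hi, hI⟩
    have hbm : s'.N b 0 = m := by rw [hs.1 b hb, hm]
    rcases Nat.eq_zero_or_pos k with rfl | hk
    · left
      obtain rfl : i = m := by omega
      simp [hi, hbm, hI]
    · right
      refine ⟨by simp [hi, hbm]; omega, ?_⟩
      refine (step i (by omega) s' hs hi hI).seq (T₂ := 6) fun s₂ h₂ hI₂ => ?_
      refine Runs.of_sem 6 ⟨k - 1, by omega, i + 1, by omega, ?_, ?_, ?_⟩ rfl (le_of_eq rfl)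
      · have h₃ : Keeps (.loop v b p) s s₂ := hs.trans
          (h₂.mono (by simp_all [Prog.loop, Prog.writesN]) (by simp_all [Prog.loop, Prog.writesQ]))
        refine h₃.trans ⟨fun a ha => ?_, fun a _ => rfl⟩
        simp only [Prog.loop, Prog.writesN, Bool.or_eq_false_iff, decide_eq_false_iff_not] at ha
        simp [Prog.sem, ha.1]
      · simp [Prog.sem, NExp.eval, h₂.1 v hv, hi]
      · exact hInv _ _ _ hI₂
  · refine ⟨fun a ha => ?_, fun a _ => rfl⟩
    simp only [Prog.loop, Prog.writesN, Bool.or_eq_false_iff, decide_eq_false_iff_not] at ha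
    simp [ha.1]

end Runs

end RAM

/-! ## Logarithmic cost from uniform cost

If a program multiplies rationals only when both factors are input cells, then all values stay short,
and the logarithmic cost is polynomial in the uniform cost and the length of the input. -/

namespace RAM

/-- Only the constants `0`, `1`, `2` occur. -/
def NExp.tame : NExp → Bool
  | const c => decide (c ≤ 2)
  | get _ e => e.tame
  | add e₁ e₂ => e₁.tame && e₂.tame
  | sub e₁ e₂ => e₁.tame && e₂.tame

/-- The only constant is `0`, and only cells of the arrays `0` and `1` are multiplied. -/
def QExp.tame : QExp → Bool
  | const c => decide (c = 0)
  | get _ e => e.tame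
  | add e₁ e₂ => e₁.tame && e₂.tame
  | sub e₁ e₂ => e₁.tame && e₂.tame
  | mul (get a e₁) (get b e₂) => decide (a < 2) && decide (b < 2) && e₁.tame && e₂.tame
  | mul _ _ => false

/-- All expressions in the test are tame. -/
def BExp.tame : BExp → Bool
  | leN e₁ e₂ => e₁.tame && e₂.tame
  | leQ e₁ e₂ => e₁.tame && e₂.tame
  | not b => b.tame
  | and b₁ b₂ => b₁.tame && b₂.tame

/-- All expressions in the program are tame, and the arrays `0` and `1` of rationals are never
written. -/
def Prog.tame : Prog → Bool
  | skip => true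
  | setN _ e v => e.tame && v.tame
  | setQ a e v => decide (2 ≤ a) && e.tame && v.tame
  | seq p q => p.tame && q.tame
  | ite c p q => c.tame && p.tame && q.tame
  | .while c p => c.tame && p.tame

/-- `q` has denominator `D` and a numerator of absolute value at most `2 ^ k`. -/
def IsFrac (D k : ℕ) (q : ℚ) : Prop := ∃ z : ℤ, q * D = z ∧ z.natAbs ≤ 2 ^ k

section IsFrac

variable {D k l : ℕ} {q r : ℚ}

theorem IsFrac.mono (h : IsFrac D k q) (hkl : k ≤ l) : IsFrac D l q := by
  obtain ⟨z, hz, hk⟩ := h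
  exact ⟨z, hz, hk.trans (Nat.pow_le_pow_right (by norm_num) hkl)⟩

theorem isFrac_zero : IsFrac D k 0 := ⟨0, by simp, by simp⟩

theorem two_pow_add_two_pow_le (k l : ℕ) : 2 ^ k + 2 ^ l ≤ 2 ^ (max k l + 1) := by
  rw [pow_succ, mul_two]
  exact Nat.add_le_add (Nat.pow_le_pow_right (by norm_num) (le_max_left _ _))
    (Nat.pow_le_pow_right (by norm_num) (le_max_right _ _))

/-- With the denominator fixed once and for all, an addition costs one bit of the numerator.
Denominators in lowest terms could multiply at each addition. -/
theorem IsFrac.add (hq : IsFrac D k q) (hr : IsFrac D l r) : IsFrac D (max k l + 1) (q + r) := by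
  obtain ⟨z, hz, hk⟩ := hq
  obtain ⟨w, hw, hl⟩ := hr
  refine ⟨z + w, by push_cast; rw [add_mul, hz, hw], (Int.natAbs_add_le z w).trans ?_⟩
  exact (Nat.add_le_add hk hl).trans (two_pow_add_two_pow_le k l)

theorem IsFrac.neg (hq : IsFrac D k q) : IsFrac D k (-q) := by
  obtain ⟨z, hz, hk⟩ := hq
  exact ⟨-z, by push_cast; rw [neg_mul, hz], by rwa [Int.natAbs_neg]⟩

theorem IsFrac.sub (hq : IsFrac D k q) (hr : IsFrac D l r) : IsFrac D (max k l + 1) (q - r) := by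
  rw [sub_eq_add_neg]
  exact hq.add hr.neg

theorem IsFrac.mul {E : ℕ} (hq : IsFrac D k q) (hr : IsFrac E l r) :
    IsFrac (D * E) (k + l) (q * r) := by
  obtain ⟨z, hz, hk⟩ := hq
  obtain ⟨w, hw, hl⟩ := hr
  refine ⟨z * w, ?_, ?_⟩
  · push_cast
    rw [← hz, ← hw]
    ring
  · rw [Int.natAbs_mul, pow_add]
    exact Nat.mul_le_mul hk hl

theorem size_le_of_le_two_pow {v : ℕ} (h : v ≤ 2 ^ k) : Nat.size v ≤ k + 1 :=
  Nat.size_le.2 (h.trans_lt (Nat.pow_lt_pow_right (by norm_num) (by omega)))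

/-- In lowest terms, numerator and denominator divide those of any other representation. -/
theorem IsFrac.ratSize_le (hD : 0 < D) (h : IsFrac D k q) : ratSize q ≤ k + 1 + Nat.size D := by
  obtain ⟨z, hz, hk⟩ := h
  have hD' : (D : ℚ) ≠ 0 := by positivity
  have hq : q = (z : ℚ) / ((D : ℤ) : ℚ) := by
    rw [Int.cast_natCast, ← hz, mul_div_cancel_right₀ _ hD']
  refine Nat.add_le_add (size_le_of_le_two_pow (le_trans ?_ hk)) (Nat.size_le_size ?_)
  · rcases eq_or_ne z 0 with rfl | hz0
    · simp [hq]
    · refine Nat.le_of_dvd (Int.natAbs_pos.2 hz0) (Int.natAbs_dvd_natAbs.2 ?_)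
      rw [hq, Rat.intCast_div_eq_divInt]
      exact Rat.num_dvd _ (Int.natCast_ne_zero.2 hD.ne')
  · refine Nat.le_of_dvd hD ?_
    have := Rat.den_dvd z D
    rw [← Rat.intCast_div_eq_divInt, ← hq] at this
    exact_mod_cast this

end IsFrac

/-- Bounds on the values in the memory: `2 ^ k` for naturals, denominator `D * D` and numerator
`2 ^ k` for rationals, and denominator `D` and numerator `2 ^ m` for the factors of products. -/
structure Bounded (D m k : ℕ) (s : State) : Prop where
  pos : 0 < D
  le : m + m ≤ k
  one_le : 1 ≤ k
  nat : ∀ a i, s.N a i ≤ 2 ^ k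
  rat : ∀ a i, IsFrac (D * D) k (s.Q a i)
  factor : ∀ a < 2, ∀ i, IsFrac D m (s.Q a i)

namespace Bounded

variable {D m k l : ℕ} {s : State}

theorem mono (h : Bounded D m k s) (hkl : k ≤ l) : Bounded D m l s where
  pos := h.pos
  le := h.le.trans hkl
  one_le := h.one_le.trans hkl
  nat a i := (h.nat a i).trans (Nat.pow_le_pow_right (by norm_num) hkl)
  rat a i := (h.rat a i).mono hkl
  factor := h.factor

theorem eval_NExp (h : Bounded D m k s) (e : NExp) (he : e.tame = true) :
    e.eval s ≤ 2 ^ (k + e.time) := by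
  induction e with
  | const c =>
    simp only [NExp.tame, decide_eq_true_eq] at he
    exact he.trans (Nat.le_self_pow (by have := h.one_le; simp [NExp.time]) 2)
  | get a e ih => exact (h.nat _ _).trans (Nat.pow_le_pow_right (by norm_num) (by omega))
  | add e₁ e₂ ih₁ ih₂ =>
    simp only [NExp.tame, Bool.and_eq_true] at he
    refine (Nat.add_le_add (ih₁ he.1) (ih₂ he.2)).trans ((two_pow_add_two_pow_le _ _).trans ?_)
    exact Nat.pow_le_pow_right (by norm_num) (by simp only [NExp.time]; omega)
  | sub e₁ e₂ ih₁ ih₂ =>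
    simp only [NExp.tame, Bool.and_eq_true] at he
    refine (Nat.sub_le _ _).trans ((ih₁ he.1).trans ?_)
    exact Nat.pow_le_pow_right (by norm_num) (by simp only [NExp.time]; omega)

theorem bits_NExp (h : Bounded D m k s) (e : NExp) (he : e.tame = true) :
    e.bits s ≤ e.time * (k + e.time + 2) := by
  have hv := size_le_of_le_two_pow (h.eval_NExp e he)
  induction e with
  | const c =>
    simp only [NExp.bits, NExp.time, NExp.eval] at *
    omega
  | get a e ih =>
    have := ih he (size_le_of_le_two_pow (h.eval_NExp e he))
    simp only [NExp.bits, NExp.time, NExp.eval] at *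
    nlinarith
  | add e₁ e₂ ih₁ ih₂ =>
    simp only [NExp.tame, Bool.and_eq_true] at he
    have h₁ := ih₁ he.1 (size_le_of_le_two_pow (h.eval_NExp _ he.1))
    have h₂ := ih₂ he.2 (size_le_of_le_two_pow (h.eval_NExp _ he.2))
    simp only [NExp.bits, NExp.time, NExp.eval] at *
    nlinarith
  | sub e₁ e₂ ih₁ ih₂ =>
    simp only [NExp.tame, Bool.and_eq_true] at he
    have h₁ := ih₁ he.1 (size_le_of_le_two_pow (h.eval_NExp _ he.1))
    have h₂ := ih₂ he.2 (size_le_of_le_two_pow (h.eval_NExp _ he.2))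
    simp only [NExp.bits, NExp.time, NExp.eval] at *
    nlinarith

theorem eval_QExp (h : Bounded D m k s) (e : QExp) (he : e.tame = true) :
    IsFrac (D * D) (k + e.time) (e.eval s) := by
  induction e with
  | const c =>
    simp only [QExp.tame, decide_eq_true_eq] at he
    subst he
    exact isFrac_zero
  | get a e => exact (h.rat _ _).mono (by omega)
  | add e₁ e₂ ih₁ ih₂ =>
    simp only [QExp.tame, Bool.and_eq_true] at he
    exact ((ih₁ he.1).add (ih₂ he.2)).mono (by simp only [QExp.time]; omega)
  | sub e₁ e₂ ih₁ ih₂ =>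
    simp only [QExp.tame, Bool.and_eq_true] at he
    exact ((ih₁ he.1).sub (ih₂ he.2)).mono (by simp only [QExp.time]; omega)
  | mul e₁ e₂ ih₁ ih₂ =>
    cases e₁ <;> cases e₂ <;> simp only [QExp.tame, Bool.false_eq_true, Bool.and_eq_true,
      decide_eq_true_eq] at he
    -- Both factors are cells with denominator `D` and `m`-bit numerators, so the product has
    -- denominator `D * D` and `m + m ≤ k` bits.
    exact ((h.factor _ he.1.1.1 _).mul (h.factor _ he.1.1.2 _)).mono (by have := h.le; omega)

theorem bits_QExp (h : Bounded D m k s) (e : QExp) (he : e.tame = true) :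
    e.bits s ≤ e.time * (k + e.time + Nat.size (D * D) + 2) := by
  have hv (e : QExp) (he : e.tame = true) := (h.eval_QExp e he).ratSize_le (Nat.mul_pos h.pos h.pos)
  have hve := hv e he
  generalize Nat.size (D * D) = L at *
  induction e with
  | const c =>
    simp only [QExp.bits, QExp.time, QExp.eval] at *
    omega
  | get a e =>
    have := h.bits_NExp e he
    simp only [QExp.bits, QExp.time, QExp.eval] at *
    nlinarith
  | add e₁ e₂ ih₁ ih₂ =>
    simp only [QExp.tame, Bool.and_eq_true] at he
    have h₁ := ih₁ he.1 (hv _ he.1)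
    have h₂ := ih₂ he.2 (hv _ he.2)
    simp only [QExp.bits, QExp.time, QExp.eval] at *
    nlinarith
  | sub e₁ e₂ ih₁ ih₂ =>
    simp only [QExp.tame, Bool.and_eq_true] at he
    have h₁ := ih₁ he.1 (hv _ he.1)
    have h₂ := ih₂ he.2 (hv _ he.2)
    simp only [QExp.bits, QExp.time, QExp.eval] at *
    nlinarith
  | mul e₁ e₂ ih₁ ih₂ =>
    have he' : e₁.tame = true ∧ e₂.tame = true := by
      cases e₁ <;> cases e₂ <;> simp_all [QExp.tame]
    have h₁ := ih₁ he'.1 (hv _ he'.1)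
    have h₂ := ih₂ he'.2 (hv _ he'.2)
    simp only [QExp.bits, QExp.time, QExp.eval] at *
    nlinarith

theorem bits_BExp (h : Bounded D m k s) (c : BExp) (hc : c.tame = true) :
    c.bits s ≤ c.time * (k + c.time + Nat.size (D * D) + 2) := by
  generalize hL : Nat.size (D * D) = L
  induction c with
  | leN e₁ e₂ =>
    simp only [BExp.tame, Bool.and_eq_true] at hc
    have h₁ := h.bits_NExp _ hc.1
    have h₂ := h.bits_NExp _ hc.2
    simp only [BExp.bits, BExp.time]
    nlinarith
  | leQ e₁ e₂ =>
    simp only [BExp.tame, Bool.and_eq_true] at hc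
    have h₁ := h.bits_QExp _ hc.1
    have h₂ := h.bits_QExp _ hc.2
    rw [hL] at h₁ h₂
    simp only [BExp.bits, BExp.time]
    nlinarith
  | not b ih =>
    have := ih hc
    simp only [BExp.bits, BExp.time]
    nlinarith
  | and b₁ b₂ ih₁ ih₂ =>
    simp only [BExp.tame, Bool.and_eq_true] at hc
    have h₁ := ih₁ hc.1
    have h₂ := ih₂ hc.2
    simp only [BExp.bits, BExp.time]
    nlinarith

end Bounded

/-- Each elementary operation lengthens the longest value by at most one bit, so after `t` of them
the exponent is at most `k + t`, and each operation is charged at most this length plus that of the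
denominator. -/
theorem Exec.bits_le {p : Prog} {s s' : State} {t b D m k : ℕ} (h : Exec p s s' t b)
    (hp : p.tame = true) (hs : Bounded D m k s) :
    Bounded D m (k + t) s' ∧ b ≤ t * (k + t + Nat.size (D * D) + 2) := by
  generalize hL : Nat.size (D * D) = L
  induction h generalizing k with
  | skip s => exact ⟨hs.mono (by omega), by omega⟩
  | setN a e v s =>
    simp only [Prog.tame, Bool.and_eq_true] at hp
    refine ⟨{ hs.mono (Nat.le_add_right k _) with nat := fun b i => ?_ }, ?_⟩
    · simp only [State.setN_N]
      split_ifs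
      · rw [Function.update_apply]
        split_ifs
        · exact (hs.eval_NExp v hp.2).trans (Nat.pow_le_pow_right (by norm_num) (by omega))
        · exact (hs.mono (Nat.le_add_right k _)).nat _ _
      · exact (hs.mono (Nat.le_add_right k _)).nat _ _
    · have h₁ := hs.bits_NExp _ hp.1
      have h₂ := hs.bits_NExp _ hp.2
      nlinarith
  | setQ a e v s =>
    simp only [Prog.tame, Bool.and_eq_true, decide_eq_true_eq] at hp
    refine ⟨{ hs.mono (Nat.le_add_right k _) with
      rat := fun b i => ?_, factor := fun b hb i => ?_ }, ?_⟩
    · simp only [State.setQ_Q]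
      split_ifs
      · rw [Function.update_apply]
        split_ifs
        · exact (hs.eval_QExp v hp.2).mono (by omega)
        · exact (hs.mono (Nat.le_add_right k _)).rat _ _
      · exact (hs.mono (Nat.le_add_right k _)).rat _ _
    -- Tame programs never write the arrays `0` and `1`, so the factors of products keep their input
    -- values.
    · rw [State.setQ_Q, if_neg (by omega)]
      exact hs.factor b hb i
    · have h₁ := hs.bits_NExp _ hp.1.2
      have h₂ := hs.bits_QExp _ hp.2
      rw [hL] at h₂
      nlinarith
  | seq h₁ h₂ ih₁ ih₂ =>
    simp only [Prog.tame, Bool.and_eq_true] at hp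
    obtain ⟨hs₁, hb₁⟩ := ih₁ hp.1 hs
    obtain ⟨hs₂, hb₂⟩ := ih₂ hp.2 hs₁
    exact ⟨hs₂.mono (by omega), by nlinarith⟩
  | ite_true hc h ih =>
    simp only [Prog.tame, Bool.and_eq_true] at hp
    obtain ⟨hs₁, hb₁⟩ := ih hp.1.2 hs
    have hb := hs.bits_BExp _ hp.1.1
    rw [hL] at hb
    exact ⟨hs₁.mono (by omega), by nlinarith⟩
  | ite_false hc h ih =>
    simp only [Prog.tame, Bool.and_eq_true] at hp
    obtain ⟨hs₁, hb₁⟩ := ih hp.2 hs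
    have hb := hs.bits_BExp _ hp.1.1
    rw [hL] at hb
    exact ⟨hs₁.mono (by omega), by nlinarith⟩
  | while_false hc =>
    simp only [Prog.tame, Bool.and_eq_true] at hp
    have hb := hs.bits_BExp _ hp.1
    rw [hL] at hb
    exact ⟨hs.mono (by omega), by nlinarith⟩
  | while_true hc h₁ h₂ ih₁ ih₂ =>
    have hp' := hp
    simp only [Prog.tame, Bool.and_eq_true] at hp
    obtain ⟨hs₁, hb₁⟩ := ih₁ hp.2 hs
    obtain ⟨hs₂, hb₂⟩ := ih₂ hp' hs₁
    have hb := hs.bits_BExp _ hp.1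
    rw [hL] at hb
    exact ⟨hs₂.mono (by omega), by nlinarith⟩

/-! ### A common denominator for the input -/

theorem two_pow_size_mul_le {u v k l : ℕ} (hu : u ≤ 2 ^ k) (hv : v ≤ 2 ^ l) :
    u * v ≤ 2 ^ (k + l) := by
  rw [pow_add]
  exact Nat.mul_le_mul hu hv

/-- The product of all denominators works: its length is at most the sum of their lengths, and the
same sum bounds the enlarged numerators. -/
theorem exists_common_den (l : List ℚ) :
    ∃ D : ℕ, 0 < D ∧ D ≤ 2 ^ (l.map fun q => ratSize q + 1).sum ∧
      ∀ q ∈ l, IsFrac D (l.map fun q => ratSize q + 1).sum q := by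
  induction l with
  | nil => exact ⟨1, by simp⟩
  | cons q l ih =>
    obtain ⟨D, hD, hle, hl⟩ := ih
    have hden : q.den ≤ 2 ^ Nat.size q.den := (Nat.lt_size_self _).le
    have hnum : q.num.natAbs ≤ 2 ^ Nat.size q.num.natAbs := (Nat.lt_size_self _).le
    refine ⟨q.den * D, Nat.mul_pos q.pos hD, ?_, ?_⟩
    · refine (two_pow_size_mul_le hden hle).trans (Nat.pow_le_pow_right (by norm_num) ?_)
      simp only [List.map_cons, List.sum_cons, ratSize]
      omega
    · intro r hr
      simp only [List.map_cons, List.sum_cons, ratSize]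
      rcases List.mem_cons.1 hr with rfl | hr
      · refine IsFrac.mono (k := Nat.size r.num.natAbs + _)
          ⟨r.num * D, ?_, ?_⟩ (Nat.add_le_add (show _ ≤ _ + _ + 1 by omega) le_rfl)
        · push_cast
          rw [← mul_assoc, Rat.mul_den_eq_num]
        · rw [Int.natAbs_mul, Int.natAbs_natCast]
          exact two_pow_size_mul_le hnum hle
      · obtain ⟨z, hz, hk⟩ := hl r hr
        refine IsFrac.mono (k := Nat.size q.den + _)
          ⟨q.den * z, ?_, ?_⟩ (Nat.add_le_add (show _ ≤ _ + _ + 1 by omega) le_rfl)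
        · push_cast
          rw [← hz]
          ring
        · rw [Int.natAbs_mul, Int.natAbs_natCast]
          exact two_pow_size_mul_le hden hk

theorem Input.bounded_state (x : Input) :
    ∃ D, Nat.size (D * D) ≤ 2 * x.size + 1 ∧ Bounded D x.size (2 * x.size + 1) x.state := by
  obtain ⟨D, hD, hle, hl⟩ := exists_common_den x.rats.flatten
  have hsum : (x.rats.flatten.map fun q => ratSize q + 1).sum =
      (x.rats.map fun l => (l.map fun q => ratSize q + 1).sum).sum := by
    rw [List.map_flatten, List.sum_flatten, List.map_map]
    rfl
  have hS : (x.rats.flatten.map fun q => ratSize q + 1).sum ≤ x.size := by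
    rw [hsum, Input.size]
    omega
  generalize (x.rats.flatten.map fun q => ratSize q + 1).sum = S at *
  have hq (a i : ℕ) : IsFrac D x.size (x.state.Q a i) := by
    show IsFrac D x.size ((x.rats.getD a []).getD i 0)
    by_cases ha : a < x.rats.length
    · rw [List.getD_eq_getElem _ _ ha]
      by_cases hi : i < (x.rats[a]).length
      · rw [List.getD_eq_getElem _ _ hi]
        exact (hl _ (List.mem_flatten.2 ⟨_, List.getElem_mem ha, List.getElem_mem hi⟩)).mono hS
      · rw [List.getD_eq_default _ _ (by omega)]
        exact isFrac_zero
    · rw [List.getD_eq_default x.rats _ (by omega)]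
      exact isFrac_zero
  have hDx : D ≤ 2 ^ x.size := hle.trans (Nat.pow_le_pow_right (by norm_num) hS)
  refine ⟨D, ?_, hD, by omega, by omega, fun a i => ?_, fun a i => ?_, fun a _ i => hq a i⟩
  · rw [two_mul]
    exact size_le_of_le_two_pow (two_pow_size_mul_le hDx hDx)
  · show (x.nats.getD a []).getD i 0 ≤ _
    by_cases ha : a < x.nats.length
    · rw [List.getD_eq_getElem _ _ ha]
      by_cases hi : i < (x.nats[a]).length
      · rw [List.getD_eq_getElem _ _ hi]
        refine (Nat.lt_size_self _).le.trans (Nat.pow_le_pow_right (by norm_num) ?_)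
        have h₁ := List.single_le_sum (l := (x.nats[a]).map fun v => Nat.size v + 1)
          (fun _ _ => Nat.zero_le _) _ (List.mem_map_of_mem (List.getElem_mem hi))
        have h₂ := List.single_le_sum
          (l := x.nats.map fun l => (l.map fun v => Nat.size v + 1).sum)
          (fun _ _ => Nat.zero_le _) _ (List.mem_map_of_mem (List.getElem_mem ha))
        rw [Input.size]
        omega
      · rw [List.getD_eq_default _ _ (by omega)]
        exact Nat.zero_le _
    · rw [List.getD_eq_default x.nats _ (by omega)]
      exact Nat.zero_le _
  · obtain ⟨z, hz, hk⟩ := hq a i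
    -- Input values are expanded from denominator `D` to `D * D`, the denominator of products.
    refine IsFrac.mono (k := x.size + x.size) ⟨z * D, ?_, ?_⟩ (by omega)
    · push_cast
      rw [← hz]
      ring
    · rw [Int.natAbs_mul, Int.natAbs_natCast]
      exact two_pow_size_mul_le hk hDx

theorem Exec.bits_le_of_input {p : Prog} {x : Input} {s : State} {t b : ℕ}
    (h : Exec p x.state s t b) (hp : p.tame = true) : b ≤ t * (4 * x.size + t + 4) := by
  obtain ⟨D, hD, hx⟩ := x.bounded_state
  refine (h.bits_le hp hx).2.trans (Nat.mul_le_mul_left t ?_)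
  omega

end RAM

/-! ## Stable marriages with forbidden pairs -/

namespace GGISM

namespace Instance

variable (I : Instance)

theorem rkM_menList (i k : Fin I.n) : I.rkM i (I.menList i k) = k + 1 := by simp [rkM]

theorem rkM_eq_iff {i j k : Fin I.n} : I.rkM i j = k + 1 ↔ j = I.menList i k := by
  rw [rkM, Nat.add_right_cancel_iff, Fin.val_inj, Equiv.symm_apply_eq]

theorem rkW_eq_iff {j i k : Fin I.n} : I.rkW j i = k + 1 ↔ i = I.womenList j k := by
  rw [rkW, Nat.add_right_cancel_iff, Fin.val_inj, Equiv.symm_apply_eq]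

theorem rkM_injective (i : Fin I.n) : Function.Injective (I.rkM i) := fun j j' h => by
  simpa [rkM, Fin.val_inj] using h

theorem rkW_injective (j : Fin I.n) : Function.Injective (I.rkW j) := fun i i' h => by
  simpa [rkW, Fin.val_inj] using h

/-- Every man `i` currently proposes to the woman in position `p i` of his list, having been rejected
by all earlier ones. This woman rejects him if the pair is not allowed, or if she has, or has had, a
proposal of a man whom she prefers. -/
def Rejects (A : Fin I.n → Fin I.n → Prop) (p : Fin I.n → ℕ) (i : Fin I.n) : Prop :=
  ∃ h : p i < I.n, ¬ A i (I.menList i ⟨p i, h⟩) ∨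
    ∃ i', I.rkM i' (I.menList i ⟨p i, h⟩) ≤ p i' + 1 ∧
      I.rkW (I.menList i ⟨p i, h⟩) i' < I.rkW (I.menList i ⟨p i, h⟩) i

/-- In all stable marriages that consist of allowed pairs, the rank of the partner of a man `i` is
more than `p i`. -/
def Safe (A : Fin I.n → Fin I.n → Prop) (p : Fin I.n → ℕ) : Prop :=
  ∀ x : I.Marriage, I.IsStable x → (∀ i, A i (x i)) → ∀ i, p i < I.rkM i (x i)

variable {I} {A : Fin I.n → Fin I.n → Prop} {p : Fin I.n → ℕ}

theorem safe_zero : I.Safe A fun _ => 0 := fun _ _ _ _ => Nat.succ_pos _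

/-- Suppose the rejected man were married to this woman in an admissible stable marriage. The pair
is then allowed, so she knows a man she prefers who has reached her in his list. By safety he is
married no better than to her, and not to her, so he and she block the marriage. -/
theorem Safe.update (hp : I.Safe A p) {i : Fin I.n} (hi : I.Rejects A p i) :
    I.Safe A (Function.update p i (p i + 1)) := by
  intro x hx hA i'
  rcases eq_or_ne i' i with rfl | hne
  · rw [Function.update_self]
    refine lt_of_le_of_ne (hp x hx hA i') fun h => ?_
    obtain ⟨hlt, hi⟩ := hi
    have hj : x i' = I.menList i' ⟨p i', hlt⟩ := I.rkM_eq_iff.1 h.symm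
    rw [← hj] at hi
    rcases hi with hi | ⟨i, h₁, h₂⟩
    · exact hi (hA i')
    · have hne : i ≠ i' := by rintro rfl; exact h₂.false
      refine hx i (x i') ⟨lt_of_le_of_ne (h₁.trans (hp x hx hA i)) fun h => hne ?_, ?_⟩
      · exact x.injective (I.rkM_injective i h).symm
      · rwa [Equiv.symm_apply_apply]
  · rw [Function.update_of_ne hne]
    exact hp x hx hA i'

/-- If two men proposed to the same woman, she would reject the worse one. If a man preferred a
woman to his own, he has already passed her in his list; since past proposals count even when the
pair is forbidden, her present partner would be rejected unless she prefers him. So stability holds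
against all pairs, not only the allowed ones. -/
theorem exists_stable_of_forall_not_rejects (h : ∀ i, ¬ I.Rejects A p i) (hp : ∀ i, p i < I.n) :
    ∃ x : I.Marriage, (∀ i, x i = I.menList i ⟨p i, hp i⟩) ∧ I.IsStable x ∧ ∀ i, A i (x i) := by
  have hinj : Function.Injective fun i => I.menList i ⟨p i, hp i⟩ := by
    have aux (i i' : Fin I.n) (hj : I.menList i ⟨p i, hp i⟩ = I.menList i' ⟨p i', hp i'⟩) :
        ¬ I.rkW (I.menList i ⟨p i, hp i⟩) i' < I.rkW (I.menList i ⟨p i, hp i⟩) i := fun hlt =>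
      h i ⟨hp i, .inr ⟨i', by rw [hj, rkM_menList], hlt⟩⟩
    intro i i' hj
    refine I.rkW_injective (I.menList i ⟨p i, hp i⟩) (le_antisymm (not_lt.1 (aux i i' hj)) ?_)
    have := not_lt.1 (aux i' i hj.symm)
    simp only at hj
    rwa [← hj] at this
  let x : I.Marriage := Equiv.ofBijective _ (Finite.injective_iff_bijective.1 hinj)
  have hx (i) : x i = I.menList i ⟨p i, hp i⟩ := rfl
  refine ⟨x, hx, fun i' j ⟨h₁, h₂⟩ => ?_, fun i => ?_⟩
  · obtain ⟨i, rfl⟩ := x.surjective j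
    rw [Equiv.symm_apply_apply] at h₂
    refine h i ⟨hp i, .inr ⟨i', ?_, ?_⟩⟩
    · rw [hx i', rkM_menList] at h₁
      exact h₁.le
    · exact h₂
  · by_contra hA
    exact h i ⟨hp i, .inl hA⟩

variable (I) in
/-- Gale and Shapley: a stable marriage exists. -/
theorem exists_isStable : ∃ x : I.Marriage, I.IsStable x := by
  let A : Fin I.n → Fin I.n → Prop := fun _ _ => True
  -- Induction on the number of proposals left. The invariant: every woman passed by a man currently
  -- has a proposal from someone she prefers to him.
  suffices H : ∀ (m : ℕ) (p : Fin I.n → ℕ), (∀ i, p i ≤ I.n) → ∑ i, (I.n - p i) = m →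
      (∀ i j, I.rkM i j ≤ p i → ∃ i', I.rkM i' j = p i' + 1 ∧ I.rkW j i' < I.rkW j i) →
      ∃ x : I.Marriage, I.IsStable x from
    H _ (fun _ => 0) (fun _ => Nat.zero_le _) rfl fun i j h => by simp [rkM] at h
  intro m
  induction m using Nat.strong_induction_on with
  | _ m ih =>
  intro p hp hm hinv
  by_cases hrej : ∃ i, I.Rejects A p i
  · obtain ⟨i, hlt, hA | ⟨i', h₁, h₂⟩⟩ := hrej
    · exact (hA trivial).elim
    have hii' : i' ≠ i := by rintro rfl; exact h₂.false
    have hrk := I.rkM_menList i ⟨p i, hlt⟩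
    set j := I.menList i ⟨p i, hlt⟩ with hj
    -- The better man `i'` may himself have moved on; then the invariant applied to him yields a
    -- current proposer who is better still.
    obtain ⟨i₂, hi₂, hr₂⟩ : ∃ i₂, I.rkM i₂ j = p i₂ + 1 ∧ I.rkW j i₂ < I.rkW j i := by
      rcases Nat.lt_or_ge (p i') (I.rkM i' j) with h | h
      · exact ⟨i', le_antisymm h₁ h, h₂⟩
      · obtain ⟨i₂, h₃, h₄⟩ := hinv i' j h
        exact ⟨i₂, h₃, h₄.trans h₂⟩
    have hne : i₂ ≠ i := by rintro rfl; exact hr₂.false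
    refine ih _ ?_ (Function.update p i (p i + 1)) (fun k => ?_) rfl fun k j' hk => ?_
    · rw [← hm]
      refine Finset.sum_lt_sum (fun k _ => ?_) ⟨i, Finset.mem_univ _, ?_⟩
      · rcases eq_or_ne k i with rfl | hk
        · rw [Function.update_self]
          omega
        · rw [Function.update_of_ne hk]
      · rw [Function.update_self]
        omega
    · rcases eq_or_ne k i with rfl | hk
      · rw [Function.update_self]
        exact hlt
      · rw [Function.update_of_ne hk]
        exact hp k
    · have hold : (∃ i', I.rkM i' j' = p i' + 1 ∧ I.rkW j' i' < I.rkW j' k) ∨ (k = i ∧ j' = j) := by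
        rcases eq_or_ne k i with rfl | hki
        · rw [Function.update_self] at hk
          rcases Nat.lt_or_ge (p k) (I.rkM k j') with h | h
          · exact .inr ⟨rfl, I.rkM_eq_iff.1 (le_antisymm hk h)⟩
          · exact .inl (hinv k j' h)
        · rw [Function.update_of_ne hki] at hk
          exact .inl (hinv k j' hk)
      rcases hold with ⟨i₃, h₃, h₄⟩ | ⟨rfl, rfl⟩
      · rcases eq_or_ne i₃ i with rfl | hne₃
        · obtain rfl : j' = j := I.rkM_eq_iff.1 h₃
          exact ⟨i₂, by rwa [Function.update_of_ne hne], hr₂.trans h₄⟩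
        · exact ⟨i₃, by rwa [Function.update_of_ne hne₃], h₄⟩
      · exact ⟨i₂, by rwa [Function.update_of_ne hne], hr₂⟩
  · push Not at hrej
    by_cases hlt : ∀ i, p i < I.n
    · obtain ⟨x, -, hx, -⟩ := exists_stable_of_forall_not_rejects hrej hlt
      exact ⟨x, hx⟩
    · push Not at hlt
      obtain ⟨i, hi⟩ := hlt
      -- If `i` has exhausted his list, every woman has a current proposer. These are distinct, so
      -- they are all the men, including `i`, who would be proposing at a rank beyond `n`.
      have hall (j : Fin I.n) : ∃ i', I.rkM i' j = p i' + 1 ∧ I.rkW j i' < I.rkW j i :=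
        hinv i j (le_trans (Nat.succ_le_of_lt (Fin.is_lt _)) hi)
      choose f hf _ using hall
      have hfinj : Function.Injective f := fun j j' h => by
        refine I.rkM_injective (f j) ?_
        rw [hf j]
        rw [h]
        exact (hf j').symm
      obtain ⟨j, hj⟩ := (Finite.injective_iff_surjective.1 hfinj) i
      have h₁ := hf j
      rw [hj] at h₁
      have h₂ : I.rkM i j ≤ I.n := Nat.succ_le_of_lt (Fin.is_lt _)
      omega

end Instance

end GGISM

/-! ## Prefixes of sorted vectors of triples -/

namespace GGISM

namespace Instance

variable (I : Instance)

/-- Rank (from `1` to `n`) of the partner of an agent. -/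
def rank (x : I.Marriage) : Fin (I.n + I.n) → ℕ :=
  Fin.append (fun i => I.rkM i (x i)) fun j => I.rkW j (x.symm j)

/-- The agent in position `k` (counted from `0`) of the list of an agent. -/
def mate (a : Fin (I.n + I.n)) (k : Fin I.n) : Fin (I.n + I.n) :=
  Fin.append (fun i => Fin.natAdd I.n (I.menList i k))
    (fun j => Fin.castAdd I.n (I.womenList j k)) a

/-- The vector of triples in which the `p`-th agent `(w p).1` has the partner in position `(w p).2`
of its list. -/
def vec {k : ℕ} (w : Fin k → Fin (I.n + I.n) × Fin I.n) :
    List (ℚ × Fin (I.n + I.n) × Fin (I.n + I.n)) :=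
  List.ofFn fun p => ((I.disutility ((w p).2 + 1) : ℚ), (w p).1, I.mate (w p).1 (w p).2)

/-- The agents `(w p).1` are sorted top agents of the marriage `x`, with partners in position
`(w p).2` of their lists. -/
structure IsTop {k : ℕ} (w : Fin k → Fin (I.n + I.n) × Fin I.n) (x : I.Marriage) : Prop where
  inj : Function.Injective fun p => (w p).1
  anti : Antitone fun p => (w p).2
  rank_eq : ∀ p, I.rank x (w p).1 = (w p).2 + 1
  rank_le : ∀ a, (∀ p, (w p).1 ≠ a) → ∀ p, I.rank x a ≤ (w p).2 + 1

variable {I} {k : ℕ} {w : Fin k → Fin (I.n + I.n) × Fin I.n} {x : I.Marriage}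

theorem disVec_eq (x : I.Marriage) (a : Fin (I.n + I.n)) :
    I.disVec x a = I.disutility (I.rank x a) := by
  induction a using Fin.addCases <;> simp [disVec, rank, -Fin.natAdd_eq_addNat]

theorem disVec_le_iff {x : I.Marriage} {a b : Fin (I.n + I.n)} :
    I.disVec x a ≤ I.disVec x b ↔ I.rank x a ≤ I.rank x b := by
  rw [disVec_eq, disVec_eq, NNRat.coe_le_coe, I.disutility_strictMono.le_iff_le]

theorem rank_pos (x : I.Marriage) (a : Fin (I.n + I.n)) : 1 ≤ I.rank x a := by
  induction a using Fin.addCases <;> simp [rank, rkM, rkW, -Fin.natAdd_eq_addNat]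

theorem rank_le_n (x : I.Marriage) (a : Fin (I.n + I.n)) : I.rank x a ≤ I.n := by
  induction a using Fin.addCases <;>
    simp only [rank, rkM, rkW, Fin.append_left, Fin.append_right] <;>
    exact Nat.succ_le_of_lt (Fin.is_lt _)

theorem partner_eq_mate_iff {x : I.Marriage} {a : Fin (I.n + I.n)} {k : Fin I.n} :
    I.partner x a = I.mate a k ↔ I.rank x a = k + 1 := by
  induction a using Fin.addCases with
  | left i => simp [partner, mate, rank, rkM_eq_iff]
  | right j => simp [partner, mate, rank, rkW_eq_iff, -Fin.natAdd_eq_addNat]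

theorem mate_injective (a : Fin (I.n + I.n)) : Function.Injective (I.mate a) := by
  induction a using Fin.addCases with
  | left i => intro k l; simp [mate]
  | right j => intro k l; simp [mate, -Fin.natAdd_eq_addNat]

theorem vec_injective : Function.Injective (I.vec (k := k)) := by
  intro w w' h
  have h := List.ofFn_injective h
  funext p
  have hp := congrFun h p
  simp only [Prod.mk.injEq] at hp
  obtain ⟨-, h₁, h₂⟩ := hp
  rw [h₁] at h₂
  exact Prod.ext h₁ (mate_injective _ h₂)

theorem vec_eq_take_iff (hk : k ≤ I.n + I.n) (σ : Equiv.Perm (Fin (I.n + I.n))) :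
    I.vec w = (List.ofFn (I.triple x ∘ σ)).take k ↔
      ∀ p, (w p).1 = σ (Fin.castLE hk p) ∧ I.rank x (w p).1 = (w p).2 + 1 := by
  have : (List.ofFn (I.triple x ∘ σ)).take k =
      List.ofFn fun p : Fin k => I.triple x (σ (Fin.castLE hk p)) := by
    refine List.ext_getElem (by simp [hk]) fun p h₁ h₂ => ?_
    simp
  rw [this, vec, List.ofFn_inj, funext_iff]
  refine forall_congr' fun p => ?_
  rw [triple, Prod.mk.injEq, Prod.mk.injEq]
  constructor
  · rintro ⟨-, h₁, h₂⟩
    refine ⟨h₁, partner_eq_mate_iff.1 ?_⟩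
    rw [h₂, h₁]
  · rintro ⟨h₁, h₂⟩
    rw [← h₁]
    refine ⟨?_, rfl, (partner_eq_mate_iff.2 h₂).symm⟩
    rw [disVec_eq, h₂]

/-- The listed agents, followed by the others sorted by decreasing rank, form a sorted enumeration
of all agents. Ties are thus broken as the word prescribes. -/
theorem exists_perm_of_isTop (hk : k ≤ I.n + I.n) (h : I.IsTop w x) :
    ∃ σ : Equiv.Perm (Fin (I.n + I.n)),
      Antitone (I.disVec x ∘ σ) ∧ ∀ p, σ (Fin.castLE hk p) = (w p).1 := by
  classical
  let r : Fin (I.n + I.n) → Fin (I.n + I.n) → Prop := fun a b => I.rank x b ≤ I.rank x a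
  have : Std.Total r := ⟨fun a b => le_total _ _⟩
  have : IsTrans _ r := ⟨fun a b c h₁ h₂ => le_trans h₂ h₁⟩
  let l₁ := List.ofFn fun p => (w p).1
  let l₂ := ((List.finRange (I.n + I.n)).filter (· ∉ l₁)).insertionSort r
  have mem₁ (a) : a ∈ l₁ ↔ ∃ p, (w p).1 = a := by simp [l₁]
  have mem₂ (a) : a ∈ l₂ ↔ a ∉ l₁ := by
    rw [(List.perm_insertionSort r _).mem_iff]
    simp
  have hnodup : (l₁ ++ l₂).Nodup := by
    refine List.Nodup.append (List.nodup_ofFn.2 h.inj) ?_ fun a h₁ h₂ => (mem₂ a).1 h₂ h₁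
    exact (List.perm_insertionSort r _).nodup_iff.2 ((List.nodup_finRange _).filter _)
  have hsort : (l₁ ++ l₂).Pairwise r := by
    refine List.pairwise_append.2 ⟨List.pairwise_ofFn.2 fun p q hpq => ?_,
      List.pairwise_insertionSort _ _, fun a ha b hb => ?_⟩
    · show _ ≤ _
      rw [h.rank_eq, h.rank_eq]
      exact Nat.succ_le_succ (h.anti hpq.le)
    · obtain ⟨p, rfl⟩ := (mem₁ a).1 ha
      show _ ≤ _
      rw [h.rank_eq]
      exact h.rank_le b (fun p hp => (mem₂ b).1 hb ((mem₁ b).2 ⟨p, hp⟩)) p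
  have hlen : (l₁ ++ l₂).length = I.n + I.n := by
    have := (List.perm_ext_iff_of_nodup hnodup (List.nodup_finRange (I.n + I.n))).2 fun a => by
      simp only [List.mem_append, mem₂, List.mem_finRange, iff_true]
      exact em _
    simpa using this.length_eq
  let f : Fin (I.n + I.n) → Fin (I.n + I.n) := fun i => (l₁ ++ l₂).get (i.cast hlen.symm)
  have hf : Function.Injective f := fun i j hij => by
    simpa using List.nodup_iff_injective_get.1 hnodup hij
  refine ⟨Equiv.ofBijective f (Finite.injective_iff_bijective.1 hf), fun i j hij => ?_,
    fun p => ?_⟩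
  · rcases hij.eq_or_lt with rfl | hij
    · exact le_rfl
    · exact disVec_le_iff.2 (List.pairwise_iff_get.1 hsort (i.cast hlen.symm) (j.cast hlen.symm) hij)
  · have hp : (p : ℕ) < l₁.length := by simp [l₁]
    show (l₁ ++ l₂).get _ = _
    simp [List.getElem_append_left hp]
    simp [l₁]

/-- Replaces quantification over all sortings by a condition on ranks, which can be tested agent by
agent. -/
theorem exists_perm_iff_isTop (hk : k ≤ I.n + I.n) :
    (∃ σ : Equiv.Perm (Fin (I.n + I.n)), Antitone (I.disVec x ∘ σ) ∧
      I.vec w = (List.ofFn (I.triple x ∘ σ)).take k) ↔ I.IsTop w x := by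
  simp only [vec_eq_take_iff hk]
  constructor
  · rintro ⟨σ, hσ, h⟩
    have hr (p) : I.rank x (σ (Fin.castLE hk p)) = (w p).2 + 1 := by rw [← (h p).1, (h p).2]
    refine ⟨fun p q hpq => ?_, fun p q hpq => ?_, fun p => (h p).2, fun a ha p => ?_⟩
    · simp only [(h _).1] at hpq
      exact Fin.castLE_injective hk (σ.injective hpq)
    · have := disVec_le_iff.1 (hσ (show Fin.castLE hk p ≤ Fin.castLE hk q from hpq))
      rw [hr, hr] at this
      exact Nat.le_of_succ_le_succ this
    · rw [← hr]
      refine disVec_le_iff.1 ?_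
      obtain ⟨i, rfl⟩ := σ.surjective a
      -- An unlisted agent cannot stand before position `p`, since the positions below `k` are
      -- occupied by listed agents.
      refine hσ (le_of_not_gt fun hi => ha ⟨i, lt_trans hi p.is_lt⟩ ?_)
      rw [(h _).1]
      rfl
  · intro h
    obtain ⟨σ, hσ, hw⟩ := exists_perm_of_isTop hk h
    exact ⟨σ, hσ, fun p => ⟨(hw p).symm, h.rank_eq p⟩⟩

theorem vec_mem_topPrefixes_iff (hk : k ≤ I.n + I.n) :
    I.vec w ∈ I.topPrefixes k ↔ ∃ x : I.Marriage, I.IsStable x ∧ I.IsTop w x := by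
  simp only [topPrefixes, Set.mem_ofPred_eq, exists_and_left, exists_perm_iff_isTop hk]

theorem exists_vec_eq_take (hk : k ≤ I.n + I.n) (x : I.Marriage)
    (σ : Equiv.Perm (Fin (I.n + I.n))) :
    ∃ w : Fin k → Fin (I.n + I.n) × Fin I.n, I.vec w = (List.ofFn (I.triple x ∘ σ)).take k := by
  refine ⟨fun p => (σ (Fin.castLE hk p), ⟨I.rank x (σ (Fin.castLE hk p)) - 1, ?_⟩),
    (vec_eq_take_iff hk σ).2 fun p => ⟨rfl, ?_⟩⟩
  · have := rank_le_n x (σ (Fin.castLE hk p))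
    have := I.n_pos
    omega
  · exact (Nat.sub_add_cancel (rank_pos _ _)).symm

theorem antitone_disVec_sort (x : I.Marriage) :
    Antitone (I.disVec x ∘ (Fin.revPerm.trans (Tuple.sort (I.disVec x)))) := fun _ _ hij =>
  Tuple.monotone_sort (I.disVec x) (Fin.rev_le_rev.2 hij)

theorem exists_isTop (hk : k ≤ I.n + I.n) (x : I.Marriage) :
    ∃ w : Fin k → Fin (I.n + I.n) × Fin I.n, I.IsTop w x := by
  obtain ⟨w, hw⟩ := exists_vec_eq_take hk x (Fin.revPerm.trans (Tuple.sort (I.disVec x)))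
  exact ⟨w, (exists_perm_iff_isTop hk).1 ⟨_, antitone_disVec_sort x, hw⟩⟩

/-! ### The index depends only on the top `K` ranks -/

variable (I) in
theorem K_le : I.K ≤ I.n + I.n := by
  simpa [K] using Finset.card_filter_le (Finset.univ : Finset (Fin (I.n + I.n))) fun i => 0 < I.weight i

/-- Monotonicity makes the positive weights an initial segment, and a count determines it. -/
theorem weight_pos_iff (i : Fin (I.n + I.n)) : 0 < I.weight i ↔ (i : ℕ) < I.K := by
  constructor
  · intro h
    have : (Finset.Iic i).card ≤ I.K := Finset.card_le_card fun j hj => by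
      simpa using h.trans_le (I.weight_antitone (Finset.mem_Iic.1 hj))
    simpa using this
  · intro h
    by_contra h0
    have : I.K ≤ (Finset.Iio i).card := Finset.card_le_card fun j hj => by
      simp only [Finset.mem_filter, Finset.mem_univ, true_and] at hj
      exact Finset.mem_Iio.2 (not_le.1 fun hij => h0 (hj.trans_le (I.weight_antitone hij)))
    simp only [Fin.card_Iio] at this
    omega

/-- Different sortings of a vector give the same sorted values, so the sorting chosen in `ggi` may
be replaced by one that starts with `w`; beyond position `K` the weights vanish. -/
theorem value_eq_of_isTop {w : Fin I.K → Fin (I.n + I.n) × Fin I.n} (h : I.IsTop w x) :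
    I.value x = ∑ p, (I.weight (Fin.castLE I.K_le p) : ℚ) * I.disutility ((w p).2 + 1) := by
  obtain ⟨σ, hσ, hw⟩ := exists_perm_of_isTop I.K_le h
  have hperm := Tuple.unique_antitone (antitone_disVec_sort x) hσ
  have hval : I.value x = ∑ i, (I.weight i : ℚ) * I.disVec x (σ i) := by
    rw [value, ggi]
    exact Finset.sum_congr rfl fun i _ => congrArg ((I.weight i : ℚ) * ·) (congrFun hperm i)
  rw [hval]
  symm
  rw [← Finset.sum_subset (Finset.subset_univ (Finset.univ.map (Fin.castLEEmb I.K_le))) ?_,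
    Finset.sum_map]
  · refine Finset.sum_congr rfl fun p _ => ?_
    rw [Fin.coe_castLEEmb, hw, disVec_eq, h.rank_eq]
  · intro i _ hi
    have : ¬ 0 < I.weight i := by
      rw [weight_pos_iff]
      intro hiK
      exact hi (Finset.mem_map.2 ⟨⟨i, hiK⟩, Finset.mem_univ _, rfl⟩)
    rw [le_antisymm (not_lt.1 this) zero_le]
    simp

/-- Words of length `k`, numbered by naturals less than `(2n * n) ^ k`. -/
def word (I : Instance) (k : ℕ) :
    Fin (((I.n + I.n) * I.n) ^ k) ≃ (Fin k → Fin (I.n + I.n) × Fin I.n) :=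
  finFunctionFinEquiv.symm.trans ((Equiv.refl _).arrowCongr finProdFinEquiv.symm)

/-- A word is a number in base `2n * n`, least significant digit first; each digit codes the agent
as quotient and the position as remainder modulo `n`. -/
theorem word_fst (t : Fin (((I.n + I.n) * I.n) ^ k)) (p : Fin k) :
    ((I.word k t p).1 : ℕ) = t / ((I.n + I.n) * I.n) ^ (p : ℕ) % ((I.n + I.n) * I.n) / I.n := rfl

theorem word_snd (t : Fin (((I.n + I.n) * I.n) ^ k)) (p : Fin k) :
    ((I.word k t p).2 : ℕ) = t / ((I.n + I.n) * I.n) ^ (p : ℕ) % ((I.n + I.n) * I.n) % I.n := rfl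

end Instance

end GGISM

/-! ## The program -/

infixr:25 ";;" => RAM.Prog.seq

namespace GGISM

open RAM RAM.Prog

/-- Given lists in the array `src`, write the ranks into the array `dst`. -/
def rankTable (src dst : ℕ) : Prog :=
  loop 30 0 (loop 31 0 (setN dst
    (.add (.get 9 (.var 30)) (.get src (.add (.get 9 (.var 30)) (.var 31))))
    (.add (.var 31) (.const 1))))

/-- `8`: the number `2n`; `9`: the multiples of `n`; `14`: the number `2n * n`. -/
def multiples : Prog :=
  setN 8 (.const 0) (.add (.var 0) (.var 0)) ;;
  setN 9 (.const 0) (.const 0) ;;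
  loop 30 8 (setN 9 (.add (.var 30) (.const 1)) (.add (.get 9 (.var 30)) (.var 0))) ;;
  setN 14 (.const 0) (.get 9 (.var 8))

/-- `12`, `13`: quotients and remainders modulo `n` of the naturals less than `2n * n`. -/
def digitTable : Prog :=
  loop 30 8 (loop 31 0
    (setN 12 (.add (.get 9 (.var 30)) (.var 31)) (.var 30) ;;
      setN 13 (.add (.get 9 (.var 30)) (.var 31)) (.var 31)))

/-- `15`: the number of positive weights. -/
def countWeights : Prog :=
  setN 15 (.const 0) (.const 0) ;;
  loop 30 8 (ite (.leQ (.get 1 (.var 30)) (.const 0)) skip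
    (setN 15 (.const 0) (.add (.var 15) (.const 1))))

/-- Computation of the tables. -/
def setup : Prog :=
  multiples ;; rankTable 1 10 ;; rankTable 2 11 ;; digitTable ;; countWeights

/-- `17`: ranks of the agents in the current word, `18`: the last rank in the word,
`19`: are the agents of the word distinct and the ranks nonincreasing? -/
def readWord : Prog :=
  loop 30 8 (setN 17 (.var 30) (.const 0)) ;;
  setN 18 (.const 0) (.var 0) ;;
  setN 19 (.const 0) (.const 1) ;;
  loop 30 15
    (setN 26 (.const 0) (.get 12 (.get 16 (.var 30))) ;;
      setN 27 (.const 0) (.add (.get 13 (.get 16 (.var 30))) (.const 1)) ;;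
      ite (.and (.leN (.get 17 (.var 26)) (.const 0)) (.leN (.var 27) (.var 18))) skip
        (setN 19 (.const 0) (.const 0)) ;;
      setN 17 (.var 26) (.var 27) ;;
      setN 18 (.const 0) (.var 27))

/-- May an agent have a partner of the given rank? -/
def allowedTest (a r : NExp) : BExp :=
  .and (.leN (.get 17 a) r) (.leN r (.add (.var 18) (.sub (.get 17 a) (.var 18))))

/-- `23`: the woman to whom the man in `31` proposes, `22`: does she reject him? -/
def rejectTest : Prog :=
  setN 23 (.const 0) (.get 1 (.add (.get 9 (.var 31)) (.get 20 (.var 31)))) ;;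
  ite (.and (allowedTest (.var 31) (.add (.get 20 (.var 31)) (.const 1)))
      (allowedTest (.add (.var 0) (.var 23)) (.get 11 (.add (.get 9 (.var 23)) (.var 31)))))
    (setN 22 (.const 0) (.const 0)) (setN 22 (.const 0) (.const 1)) ;;
  loop 32 0
    (ite (.and (.leN (.get 10 (.add (.get 9 (.var 32)) (.var 23)))
          (.add (.get 20 (.var 32)) (.const 1)))
        (.ltN (.get 11 (.add (.get 9 (.var 23)) (.var 32)))
          (.get 11 (.add (.get 9 (.var 23)) (.var 31)))))
      (setN 22 (.const 0) (.const 1)) skip)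

/-- One round of proposals of all men; `21`: has someone been rejected? -/
def round : Prog :=
  setN 21 (.const 0) (.const 0) ;;
  loop 31 0
    (ite (.ltN (.get 20 (.var 31)) (.var 0))
      (rejectTest ;;
        ite (.leN (.const 1) (.var 22))
          (setN 20 (.var 31) (.add (.get 20 (.var 31)) (.const 1)) ;;
            setN 21 (.const 0) (.const 1)) skip) skip)

/-- Rounds of proposals until nobody is rejected; `20`: the positions of the men in their lists,
`19`: is the result a marriage? -/
def propose : Prog :=
  loop 31 0 (setN 20 (.var 31) (.const 0)) ;;
  setN 21 (.const 0) (.const 1) ;;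
  .while (.leN (.const 1) (.var 21)) round ;;
  loop 31 0 (ite (.ltN (.get 20 (.var 31)) (.var 0)) skip (setN 19 (.const 0) (.const 0)))

/-- Append the current vector to the output (`24` is the first free cell), and compute its value in
the cell `0` of the array `4` of rationals. -/
def emit : Prog :=
  setQ 4 (.const 0) (.const 0) ;;
  loop 30 15
    (setN 23 (.const 0) (.get 16 (.var 30)) ;;
      setQ 4 (.const 0) (.add (.get 4 (.const 0))
        (.mul (.get 1 (.var 30)) (.get 0 (.get 13 (.var 23))))) ;;
      setQ 3 (.var 24) (.get 0 (.get 13 (.var 23))) ;;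
      setN 5 (.var 24) (.get 12 (.var 23)) ;;
      ite (.ltN (.get 12 (.var 23)) (.var 0))
        (setN 6 (.var 24) (.add (.var 0) (.get 1 (.var 23))))
        (setN 6 (.var 24) (.get 2 (.sub (.var 23) (.get 9 (.var 0))))) ;;
      setN 24 (.const 0) (.add (.var 24) (.const 1)))

/-- Keep the current marriage if it is the first or better than the best one so far, whose value is
in the cell `0` of the array `5` of rationals. -/
def update : Prog :=
  ite (.and (.leN (.const 1) (.var 4)) (.leQ (.get 5 (.const 0)) (.get 4 (.const 0)))) skip
    (setQ 5 (.const 0) (.get 4 (.const 0)) ;;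
      loop 31 0
        (setN 3 (.var 31) (.get 1 (.add (.get 9 (.var 31)) (.get 20 (.var 31)))))) ;;
  setN 4 (.const 0) (.add (.var 4) (.const 1))

/-- Proceed to the next word, whose digits are in `16`; `25`: were all digits maximal? -/
def nextWord : Prog :=
  setN 25 (.const 0) (.const 1) ;;
  loop 30 15
    (ite (.leN (.const 1) (.var 25))
      (ite (.ltN (.add (.get 16 (.var 30)) (.const 1)) (.var 14))
        (setN 16 (.var 30) (.add (.get 16 (.var 30)) (.const 1)) ;;
          setN 25 (.const 0) (.const 0))
        (setN 16 (.var 30) (.const 0))) skip)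

/-- Treatment of one word. -/
def treatWord : Prog :=
  readWord ;;
  ite (.leN (.const 1) (.var 19))
    (propose ;; ite (.leN (.const 1) (.var 19)) (emit ;; update) skip) skip ;;
  nextWord

/-- The whole program. -/
def program : Prog :=
  setup ;;
  .while (.leN (.var 25) (.const 0)) treatWord ;;
  ite (.leQ (.get 5 (.const 0)) (.get 2 (.const 0))) (setN 7 (.const 0) (.const 1)) skip

/-- The only product is weight times disutility in `emit`. -/
theorem program_tame : program.tame = true := by decide

/-! ## Verification of the tables -/

theorem mul_add_inj {n i j i' j' : ℕ} (hj : j < n) (hj' : j' < n) :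
    i * n + j = i' * n + j' ↔ i = i' ∧ j = j' := by
  refine ⟨fun h => ?_, by rintro ⟨rfl, rfl⟩; rfl⟩
  have hn : 0 < n := by omega
  have h₁ := congrArg (· / n) h
  have h₂ := congrArg (· % n) h
  simp only [mul_comm _ n,
    Nat.mul_add_div hn, Nat.div_eq_of_lt hj, Nat.div_eq_of_lt hj', add_zero, Nat.mul_add_mod,
    Nat.mod_eq_of_lt hj, Nat.mod_eq_of_lt hj'] at h₁ h₂
  exact ⟨h₁, h₂⟩

/-- Reading list `i` in order tabulates the inverse of `L i`; the cells written are distinct because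
`L i` is injective and rows do not overlap. -/
theorem runs_rankTable {n src dst : ℕ} {s : State} (L : Fin n → Equiv.Perm (Fin n))
    (hn : s.N 0 0 = n) (hbase : ∀ i < n, s.N 9 i = i * n)
    (hsrc : ∀ i k : Fin n, s.N src (i * n + k) = (L i k : ℕ))
    (hd : dst ∉ [0, 9, 30, 31, src]) (hs : src ∉ [30, 31]) :
    Runs (rankTable src dst) s (n * (n * 33 + 23) + 10) fun s' =>
      ∀ i j : Fin n, s'.N dst (i * n + j) = ((L i).symm j : ℕ) + 1 := by
  simp only [List.mem_cons, List.not_mem_nil, or_false, not_or] at hd hs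
  obtain ⟨h0, h9, h30, h31, hsd⟩ := hd
  refine (Runs.loop (T := n * 33 + 10)
    (Inv := fun i s' => ∀ i' : Fin n, i' < i → ∀ k, s'.N dst (i' * n + L i' k) = k + 1)
    hn (by simp [h30]) (by simp) (fun i hi s₁ hk₁ hi₁ hI₁ => ?_)
    (by simp [loop, writesN, Ne.symm h30]) (by simp [loop, writesN, Ne.symm h0])).mono (by linarith)
    fun s' _ h i j => ?_
  · have hk₁N := hk₁.1
    simp only [loop, writesN, Bool.or_eq_false_iff,
      ] at hk₁N
    refine (Runs.loop (T := 20) (m := n) (Inv := fun k s' =>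
      (∀ i' : Fin n, i' < i → ∀ k, s'.N dst (i' * n + L i' k) = k + 1) ∧
        ∀ k' : Fin n, k' < k → s'.N dst (i * n + L ⟨i, hi⟩ k') = k' + 1) ?_ (by simp [h31])
      ⟨hI₁, by simp⟩ (fun k hk s₂ hk₂ hk₂' hI₂ => ?_)
      (by simp [writesN, Ne.symm h31]) (by simp [loop, writesN, Ne.symm h0])).imp
      fun s' _ h i' hi' k => ?_
    · rw [hk₁N 0 (by simp [Ne.symm h0]), hn]
    · have hk₂N := hk₂.1
      simp only [loop, writesN, Bool.or_eq_false_iff,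
        ] at hk₂N
      have e30 : s₂.N 30 0 = i := by rw [hk₂N 30 (by simp [Ne.symm h30]), hi₁]
      have e9 : s₂.N 9 i = i * n := by
        rw [hk₂N 9 (by simp [Ne.symm h9]), hk₁N 9 (by simp [Ne.symm h9]), hbase i hi]
      have esrc : s₂.N src (i * n + k) = L ⟨i, hi⟩ ⟨k, hk⟩ := by
        rw [hk₂N src (by simp [Ne.symm hsd, hs]), hk₁N src (by simp [Ne.symm hsd, hs])]
        exact hsrc ⟨i, hi⟩ ⟨k, hk⟩
      refine Runs.of_sem 20 ?_ (by simp [loopFree]) (by simp [cost, NExp.time, NExp.var])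
      simp only [sem, NExp.eval, NExp.eval_var, State.setN_N, e30, e9, hk₂', esrc, if_true,
        Function.update_apply, mul_add_inj (Fin.is_lt _) (Fin.is_lt _), Fin.val_inj,
        EmbeddingLike.apply_eq_iff_eq]
      refine ⟨fun i' hi' k' => ?_, fun k' hk' => ?_⟩
      · rw [if_neg (by omega)]
        exact hI₂.1 i' hi' k'
      · split_ifs with h
        · rw [h.2]
        · refine hI₂.2 k' (lt_of_le_of_ne (Nat.le_of_lt_succ hk') fun h' => h ⟨trivial, Fin.ext h'⟩)
    · rcases Nat.lt_succ_iff_lt_or_eq.1 hi' with hi' | rfl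
      · exact h.1 i' hi' k
      · exact h.2 k k.is_lt
  · have := h i i.is_lt ((L i).symm j)
    rwa [Equiv.apply_symm_apply] at this

/-- The machine cannot multiply naturals, so the row offsets are accumulated by repeated addition.
Likewise, division by `n` is tabulated in `digitTable`. -/
theorem runs_multiples {n : ℕ} {s : State} (hn : s.N 0 0 = n) :
    Runs multiples s (n * 60 + 40) fun s' =>
      s'.N 8 0 = n + n ∧ (∀ i ≤ n + n, s'.N 9 i = i * n) ∧ s'.N 14 0 = (n + n) * n := by
  refine ((Runs.of_sem 10 (Q := fun s' => s'.N 0 0 = n ∧ s'.N 8 0 = n + n)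
    (by simp [sem, NExp.eval, hn])).seq fun s₁ _ h₁ => ?_).le (T₁ := 10 + (n * 60 + 30)) (by omega)
  refine ((Runs.of_sem 4 (Q := fun s' => s'.N 0 0 = n ∧ s'.N 8 0 = n + n ∧ s'.N 9 0 = 0)
    (by simp [sem, NExp.eval, h₁])).seq fun s₂ _ h₂ => ?_).le (T₁ := 4 + (n * 60 + 25)) (by omega)
  refine ((Runs.loop (T := 14) (m := n + n) (Inv := fun i s' => ∀ i' ≤ i, s'.N 9 i' = i' * n)
    h₂.2.1 (by simp) (by simp [h₂]) (fun i hi s₃ hk₃ hi₃ h₃ => ?_)).seq (T₂ := 8)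
    fun s₃ hk₃ h₃ => ?_).le (by omega)
  · have e0 : s₃.N 0 0 = n := by rw [hk₃.1 0 (by decide), h₂.1]
    refine Runs.of_sem 14 fun i' hi' => ?_
    simp only [sem, NExp.eval, NExp.eval_var, State.setN_N, hi₃, e0, h₃ i le_rfl,
      Function.update_apply, if_true]
    split_ifs with h
    · rw [h, Nat.succ_mul]
    · exact h₃ i' (by omega)
  · refine Runs.of_sem 8 ?_
    have e8 : s₃.N 8 0 = n + n := by rw [hk₃.1 8 (by decide), h₂.2.1]
    refine ⟨by simpa [sem] using e8, fun i hi => by simpa [sem] using h₃ i hi, ?_⟩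
    simp [sem, NExp.eval, e8, h₃]

theorem runs_digitTable {n : ℕ} {s : State} (hn : s.N 0 0 = n) (h8 : s.N 8 0 = n + n)
    (hbase : ∀ i ≤ n + n, s.N 9 i = i * n) :
    Runs digitTable s ((n + n) * (n * 34 + 23) + 10) fun s' =>
      ∀ t < (n + n) * n, s'.N 12 t = t / n ∧ s'.N 13 t = t % n := by
  refine (Runs.loop (T := n * 34 + 10) (Inv := fun i s' => ∀ i' < i, ∀ k' < n,
    s'.N 12 (i' * n + k') = i' ∧ s'.N 13 (i' * n + k') = k') h8 (by simp) (by simp)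
    fun i hi s₁ hk₁ hi₁ h₁ => ?_).mono (by linarith) fun s' _ h t ht => ?_
  · refine (Runs.loop (T := 21) (m := n) (Inv := fun k s' => ∀ i' k', k' < n →
      (i' < i ∨ i' = i ∧ k' < k) → s'.N 12 (i' * n + k') = i' ∧ s'.N 13 (i' * n + k') = k')
      ?_ (by simp) ?_ fun k hk s₂ hk₂ hk₂' h₂ => ?_).mono (by omega) fun s' _ h i' hi' k' hk' => ?_
    · rw [hk₁.1 0 (by decide), hn]
    · intro i' k' hk' h
      exact h₁ i' (by omega) k' hk'
    · have e30 : s₂.N 30 0 = i := by rw [hk₂.1 30 (by decide), hi₁]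
      have e9 : s₂.N 9 i = i * n := by
        rw [hk₂.1 9 (by decide), hk₁.1 9 (by decide), hbase i hi.le]
      refine Runs.of_sem 21 fun i' k' hk' h => ?_
      simp only [sem, NExp.eval, NExp.eval_var, State.setN_N, e30, e9, hk₂', Function.update_apply,
        if_true, Nat.reduceEqDiff, if_false, mul_add_inj hk' hk]
      split_ifs with h'
      · exact ⟨h'.1.symm, h'.2.symm⟩
      · exact h₂ i' k' hk' (by omega)
    · exact h i' k' hk' (by omega)
  · have hn : 0 < n := Nat.pos_of_ne_zero (by rintro rfl; simp at ht)
    have := h (t / n) ((Nat.div_lt_iff_lt_mul hn).2 ht) (t % n) (Nat.mod_lt _ hn)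
    rwa [Nat.div_add_mod'] at this

theorem runs_countWeights {I : Instance} {s : State} (h8 : s.N 8 0 = I.n + I.n)
    (hw : ∀ i : Fin (I.n + I.n), s.Q 1 i = I.weight i) :
    Runs countWeights s ((I.n + I.n) * 30 + 20) fun s' => s'.N 15 0 = I.K := by
  refine ((Runs.of_sem 3 (Q := fun s' => s'.N 15 0 = 0 ∧ s'.N 8 0 = I.n + I.n)
    (by simp [sem, NExp.eval, h8])).seq fun s₁ hk₁ h₁ => ?_).le
    (T₁ := 3 + ((I.n + I.n) * 30 + 10)) (by omega)
  -- The form `min i K` is right because the positive weights come first.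
  refine (Runs.loop (T := 12) (Inv := fun i s' => s'.N 15 0 = min i I.K) h₁.2 (by simp)
    (by simp [h₁]) fun i hi s₂ hk₂ hi₂ h₂ => ?_).mono (by omega) fun s' _ h => ?_
  · refine Runs.of_sem 12 ?_
    have e : s₂.Q 1 i = I.weight ⟨i, hi⟩ := by
      rw [hk₂.2 1 (by decide), hk₁.2 1 (by decide)]
      exact hw ⟨i, hi⟩
    have hpos := I.weight_pos_iff ⟨i, hi⟩
    simp only [sem, BExp.leQ_iff, QExp.eval, NExp.eval_var, hi₂, e]
    split_ifs with h
    · have : ¬ i < I.K := by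
        rw [← hpos, not_lt]
        exact_mod_cast h
      rw [h₂]
      omega
    · have : i < I.K := by
        rw [← hpos]
        exact_mod_cast not_le.1 h
      simp only [NExp.eval, NExp.eval_var, State.setN_N, if_true, Function.update_self, h₂]
      omega
  · rw [h]
    exact min_eq_right I.K_le

/-- The memory contains the input and the tables. -/
structure Tables (I : Instance) (s : State) : Prop where
  n : s.N 0 0 = I.n
  men (i k : Fin I.n) : s.N 1 (i * I.n + k) = I.menList i k
  women (j k : Fin I.n) : s.N 2 (j * I.n + k) = I.womenList j k
  dis (k : Fin I.n) : s.Q 0 k = I.disutility (k + 1)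
  weight (i : Fin (I.n + I.n)) : s.Q 1 i = I.weight i
  two : s.N 8 0 = I.n + I.n
  base : ∀ i ≤ I.n + I.n, s.N 9 i = i * I.n
  rkM (i j : Fin I.n) : s.N 10 (i * I.n + j) = I.rkM i j
  rkW (j i : Fin I.n) : s.N 11 (j * I.n + i) = I.rkW j i
  digit : ∀ t < (I.n + I.n) * I.n, s.N 12 t = t / I.n ∧ s.N 13 t = t % I.n
  card : s.N 14 0 = (I.n + I.n) * I.n
  K : s.N 15 0 = I.K

/-- Does the program leave the arrays of the input and the tables unchanged? -/
def keepsTables (p : Prog) : Bool :=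
  [0, 1, 2, 8, 9, 10, 11, 12, 13, 14, 15].all (fun a => !p.writesN a) &&
    [0, 1].all fun a => !p.writesQ a

theorem Tables.of_keeps {I : Instance} {s s' : State} {p : Prog} (h : Tables I s)
    (hk : Keeps p s s') (hp : keepsTables p = true := by decide) : Tables I s' := by
  simp only [keepsTables, List.all_cons, List.all_nil, Bool.and_true, Bool.and_eq_true,
    Bool.not_eq_true'] at hp
  obtain ⟨⟨e0, e1, e2, e8, e9, e10, e11, e12, e13, e14, e15⟩, q0, q1⟩ := hp
  have hN := hk.1
  have hQ := hk.2
  constructor <;> simp only [hN _ e0, hN _ e1, hN _ e2, hN _ e8, hN _ e9, hN _ e10, hN _ e11,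
    hN _ e12, hN _ e13, hN _ e14, hN _ e15, hQ _ q0, hQ _ q1]
  exacts [h.n, h.men, h.women, h.dis, h.weight, h.two, h.base, h.rkM, h.rkW, h.digit, h.card, h.K]

theorem getD_ofFn {α : Type*} {m : ℕ} (f : Fin m → α) (d : α) (i : Fin m) :
    (List.ofFn f).getD i d = f i := by
  rw [List.getD_eq_getElem _ _ (by simp)]
  simp

theorem getD_ofFn_mul {α : Type*} {n : ℕ} (f : Fin n → Fin n → α) (d : α) (i k : Fin n) :
    (List.ofFn fun t : Fin (n * n) => f t.divNat t.modNat).getD (i * n + k) d = f i k := by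
  have h := getD_ofFn (fun t : Fin (n * n) => f t.divNat t.modNat) d (finProdFinEquiv (i, k))
  have h' : finProdFinEquiv.symm (finProdFinEquiv (i, k)) = (i, k) :=
    Equiv.symm_apply_apply _ _
  rw [finProdFinEquiv_symm_apply, Prod.mk.injEq] at h'
  rw [h'.1, h'.2] at h
  rw [← h]
  congr 1
  simp [finProdFinEquiv, mul_comm, add_comm]

theorem runs_setup (I : Instance) (extra : List (List ℚ)) :
    Runs setup (I.encode extra).state (I.n ^ 4 * 500) fun s => Tables I s := by
  set s := (I.encode extra).state with hs
  have hn : s.N 0 0 = I.n := rfl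
  have hmen (i k : Fin I.n) : s.N 1 (i * I.n + k) = (I.menList i k : ℕ) :=
    getD_ofFn_mul (fun i k => (I.menList i k : ℕ)) 0 i k
  have hwomen (j k : Fin I.n) : s.N 2 (j * I.n + k) = (I.womenList j k : ℕ) :=
    getD_ofFn_mul (fun i k => (I.womenList i k : ℕ)) 0 j k
  have hdis (k : Fin I.n) : s.Q 0 k = I.disutility (k + 1) :=
    getD_ofFn (fun k : Fin I.n => (I.disutility (k + 1) : ℚ)) 0 k
  have hweight (i : Fin (I.n + I.n)) : s.Q 1 i = I.weight i :=
    getD_ofFn (fun i => (I.weight i : ℚ)) 0 i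
  refine Runs.le (Runs.seq (T₂ := I.n * (I.n * 33 + 23) + 10 + (I.n * (I.n * 33 + 23) + 10 +
    ((I.n + I.n) * (I.n * 34 + 23) + 10 + ((I.n + I.n) * 30 + 20)))) (runs_multiples hn)
    fun s₁ hk₁ ⟨h8, h9, h14⟩ => ?run) ?le
  case run =>
    refine (runs_rankTable (src := 1) (dst := 10) I.menList (by rw [hk₁.1 0 (by decide), hn])
      (fun i hi => h9 i (by omega)) (fun i k => by rw [hk₁.1 1 (by decide), hmen])
      (by decide) (by decide)).seq fun s₂ hk₂ h10 => ?_
    have h9₂ := hk₂.1 9 (by decide)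
    refine (runs_rankTable (src := 2) (dst := 11) I.womenList
      (by rw [hk₂.1 0 (by decide), hk₁.1 0 (by decide), hn])
      (fun i hi => by rw [h9₂, h9 i (by omega)])
      (fun i k => by rw [hk₂.1 2 (by decide), hk₁.1 2 (by decide), hwomen])
      (by decide) (by decide)).seq fun s₃ hk₃ h11 => ?_
    refine (runs_digitTable
      (by rw [hk₃.1 0 (by decide), hk₂.1 0 (by decide), hk₁.1 0 (by decide), hn])
      (by rw [hk₃.1 8 (by decide), hk₂.1 8 (by decide), h8])
      (fun i hi => by rw [hk₃.1 9 (by decide), h9₂, h9 i hi])).seq fun s₄ hk₄ h12 => ?_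
    refine (runs_countWeights (I := I)
      (by rw [hk₄.1 8 (by decide), hk₃.1 8 (by decide), hk₂.1 8 (by decide), h8]) (fun i => by
        rw [hk₄.2 1 (by decide), hk₃.2 1 (by decide), hk₂.2 1 (by decide), hk₁.2 1 (by decide),
          hweight])).imp fun s₅ hk₅ h15 => ?_
    constructor
    · rw [hk₅.1 0 (by decide), hk₄.1 0 (by decide), hk₃.1 0 (by decide), hk₂.1 0 (by decide),
        hk₁.1 0 (by decide), hn]
    · rw [hk₅.1 1 (by decide), hk₄.1 1 (by decide), hk₃.1 1 (by decide), hk₂.1 1 (by decide),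
        hk₁.1 1 (by decide)]
      exact hmen
    · rw [hk₅.1 2 (by decide), hk₄.1 2 (by decide), hk₃.1 2 (by decide), hk₂.1 2 (by decide),
        hk₁.1 2 (by decide)]
      exact hwomen
    · rw [hk₅.2 0 (by decide), hk₄.2 0 (by decide), hk₃.2 0 (by decide), hk₂.2 0 (by decide),
        hk₁.2 0 (by decide)]
      exact hdis
    · rw [hk₅.2 1 (by decide), hk₄.2 1 (by decide), hk₃.2 1 (by decide), hk₂.2 1 (by decide),
        hk₁.2 1 (by decide)]
      exact hweight
    · rw [hk₅.1 8 (by decide), hk₄.1 8 (by decide), hk₃.1 8 (by decide), hk₂.1 8 (by decide), h8]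
    · rw [hk₅.1 9 (by decide), hk₄.1 9 (by decide), hk₃.1 9 (by decide), h9₂]
      exact h9
    · rw [hk₅.1 10 (by decide), hk₄.1 10 (by decide), hk₃.1 10 (by decide)]
      exact h10
    · rw [hk₅.1 11 (by decide), hk₄.1 11 (by decide)]
      exact h11
    · rw [hk₅.1 12 (by decide), hk₅.1 13 (by decide)]
      exact h12
    · rw [hk₅.1 14 (by decide), hk₄.1 14 (by decide), hk₃.1 14 (by decide), hk₂.1 14 (by decide),
        h14]
    · exact h15
  case le =>
    have h₁ := I.n_pos
    have h₂ : I.n ≤ I.n ^ 4 := Nat.le_self_pow (by norm_num) _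
    have h₃ : I.n * I.n ≤ I.n ^ 4 := by
      rw [← sq]
      exact Nat.pow_le_pow_right h₁ (by norm_num)
    nlinarith

end GGISM

/-! ## Verification of the search for a marriage -/

namespace GGISM

open RAM RAM.Prog

/-- An agent with entry `l` in array `17` may have a partner of rank `r`. -/
def RankAllowed (l h r : ℕ) : Prop := l ≤ r ∧ r ≤ h + (l - h)

namespace Instance

/-- A pair is allowed if both ranks are allowed. -/
def PairAllowed (I : Instance) (lo : ℕ → ℕ) (h : ℕ) (i j : Fin I.n) : Prop :=
  RankAllowed (lo i) h (I.rkM i j) ∧ RankAllowed (lo (I.n + j)) h (I.rkW j i)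

variable {I : Instance} {k : ℕ} {w : Fin k → Fin (I.n + I.n) × Fin I.n} {x : I.Marriage}
  {lo : ℕ → ℕ} {h : ℕ}

theorem forall_pairAllowed_iff :
    (∀ i, I.PairAllowed lo h i (x i)) ↔
      ∀ a : Fin (I.n + I.n), RankAllowed (lo a) h (I.rank x a) := by
  constructor
  · intro H a
    induction a using Fin.addCases with
    | left i => simpa [rank] using (H i).1
    | right j => simpa [rank, -Fin.natAdd_eq_addNat] using (H (x.symm j)).2
  · intro H i
    exact ⟨by simpa [rank] using H (Fin.castAdd _ i),
      by simpa [rank, -Fin.natAdd_eq_addNat] using H (Fin.natAdd _ (x i))⟩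

/-- The bounds `lo`, `h` on ranks that a word imposes. -/
structure Bounds (w : Fin k → Fin (I.n + I.n) × Fin I.n) (lo : ℕ → ℕ) (h : ℕ) : Prop where
  mem (p : Fin k) : lo (w p).1 = (w p).2 + 1
  not_mem (a : Fin (I.n + I.n)) : (∀ p, (w p).1 ≠ a) → lo a = 0
  le (p : Fin k) : h ≤ (w p).2 + 1
  eq : (k = 0 ∧ h = I.n) ∨ ∃ p, h = (w p).2 + 1

/-- The upper bound `h + (l - h)` is `max h l`. A listed agent has `l` equal to its rank and `h ≤
l`, which forces the rank; any other agent has `l = 0`, which leaves only the bound `h`. -/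
theorem Bounds.isTop_iff (hb : Bounds w lo h) (hinj : Function.Injective fun p => (w p).1)
    (hanti : Antitone fun p => (w p).2) :
    I.IsTop w x ↔ ∀ i, I.PairAllowed lo h i (x i) := by
  rw [forall_pairAllowed_iff]
  constructor
  · intro H a
    by_cases ha : ∃ p, (w p).1 = a
    · obtain ⟨p, rfl⟩ := ha
      have := hb.le p
      rw [RankAllowed, hb.mem, H.rank_eq]
      omega
    · push Not at ha
      rw [RankAllowed, hb.not_mem a ha]
      refine ⟨Nat.zero_le _, ?_⟩
      rcases hb.eq with ⟨-, he⟩ | ⟨p, he⟩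
      · have := rank_le_n x a
        omega
      · have := H.rank_le a ha p
        omega
  · intro H
    refine ⟨hinj, hanti, fun p => ?_, fun a ha p => ?_⟩
    · have h₁ := H (w p).1
      rw [RankAllowed, hb.mem] at h₁
      have := hb.le p
      omega
    · have h₁ := H a
      rw [RankAllowed, hb.not_mem a ha] at h₁
      have := hb.le p
      omega

end Instance

open Instance

variable {I : Instance} {s : State}

/-- The digits of the current word. -/
def HasWord (w : Fin I.K → Fin (I.n + I.n) × Fin I.n) (s : State) : Prop :=
  ∀ p : Fin I.K, s.N 16 p = (w p).1 * I.n + (w p).2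

theorem Tables.digit_eq (hT : Tables I s) (a : Fin (I.n + I.n)) (k : Fin I.n) :
    s.N 12 (a * I.n + k) = a ∧ s.N 13 (a * I.n + k) = k := by
  have hlt : (a : ℕ) * I.n + k < (I.n + I.n) * I.n := by
    have := Nat.mul_le_mul_right I.n (Nat.succ_le_of_lt a.is_lt)
    have := k.is_lt
    rw [Nat.succ_mul] at *
    omega
  obtain ⟨h₁, h₂⟩ := hT.digit _ hlt
  rw [h₁, h₂]
  have h₃ := Nat.div_add_mod' ((a : ℕ) * I.n + k) I.n
  exact (mul_add_inj (Nat.mod_lt _ I.n_pos) k.is_lt).1 h₃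

/-- An entry `0` in array `17` means that the agent has not occurred, as ranks start at `1`. Cell
`18` starts at `n`, which admits any first rank and, for `K = 0`, every rank. -/
theorem runs_readWord {w : Fin I.K → Fin (I.n + I.n) × Fin I.n} (hT : Tables I s)
    (hw : HasWord w s) :
    Runs readWord s (I.n * 300 + 60) fun s' =>
      (1 ≤ s'.N 19 0 ↔ (Function.Injective fun p => (w p).1) ∧ Antitone fun p => (w p).2) ∧
      (1 ≤ s'.N 19 0 → Bounds w (s'.N 17) (s'.N 18 0)) := by
  have hK := I.K_le
  refine Runs.le (Runs.seq (T₂ := 4 + (4 + (I.K * (60 + 13) + 10)))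
    (Runs.loop (T := 5) (Inv := fun i s' => ∀ a < i, s'.N 17 a = 0) hT.two (by simp) (by simp)
      fun i hi s₁ hk₁ hi₁ h₁ => Runs.of_sem 5 ?_) fun s₁ hk₁ h₁ => ?_) (by omega)
  · intro a ha
    simp only [sem, NExp.eval, NExp.eval_var, State.setN_N, hi₁, if_true, Function.update_apply]
    split_ifs
    · rfl
    · exact h₁ a (by omega)
  have hT₁ := hT.of_keeps hk₁
  have hw₁ : HasWord w s₁ := fun p => by rw [hk₁.1 16 (by decide), hw p]
  refine (Runs.of_sem 4 (Q := fun s' => s'.N 17 = s₁.N 17 ∧ s'.N 18 0 = I.n)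
    (by simp [sem, NExp.eval, hT₁.n])).seq fun s₂ hk₂ h₂ => ?_
  have hT₂ := hT₁.of_keeps hk₂
  have hw₂ : HasWord w s₂ := fun p => by rw [hk₂.1 16 (by decide), hw₁ p]
  refine (Runs.of_sem 4 (Q := fun s' => s'.N 17 = s₂.N 17 ∧ s'.N 18 0 = I.n ∧ 1 ≤ s'.N 19 0)
    (by simp [sem, NExp.eval, h₂])).seq fun s₃ hk₃ h₃ => ?_
  have hT₃ := hT₂.of_keeps hk₃
  have hw₃ : HasWord w s₃ := fun p => by rw [hk₃.1 16 (by decide), hw₂ p]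
  -- The contents of `17` and `18` are described only while the word is good; after a failure they
  -- are never used.
  refine (Runs.loop (T := 60) (Inv := fun q s' =>
    (1 ≤ s'.N 19 0 ↔ ∀ p p' : Fin I.K, p < p' → p' < q →
      (w p).1 ≠ (w p').1 ∧ (w p').2 ≤ (w p).2) ∧
    (1 ≤ s'.N 19 0 → (∀ p : Fin I.K, p < q → s'.N 17 (w p).1 = (w p).2 + 1) ∧
      (∀ a : Fin (I.n + I.n), (∀ p : Fin I.K, p < q → (w p).1 ≠ a) → s'.N 17 a = 0) ∧
      (∀ p : Fin I.K, p < q → s'.N 18 0 ≤ (w p).2 + 1) ∧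
      ((q = 0 ∧ s'.N 18 0 = I.n) ∨ ∃ p : Fin I.K, p + 1 = q ∧ s'.N 18 0 = (w p).2 + 1)))
    hT₃.K (by simp) ?_ fun q hq s₄ hk₄ hq₄ h₄ => ?_).imp fun s' _ h => ?_
  · refine ⟨by simp [h₃], fun _ => ⟨by simp, fun a _ => ?_, by simp, .inl ⟨rfl, h₃.2.1⟩⟩⟩
    rw [h₃.1, h₂.1, h₁ a a.is_lt]
  · have hT₄ := hT₃.of_keeps hk₄
    have hw₄ : s₄.N 16 q = (w ⟨q, hq⟩).1 * I.n + (w ⟨q, hq⟩).2 := by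
      rw [hk₄.1 16 (by decide)]
      exact hw₃ ⟨q, hq⟩
    obtain ⟨e12, e13⟩ := hT₄.digit_eq (w ⟨q, hq⟩).1 (w ⟨q, hq⟩).2
    have key : (1 ≤ s₄.N 19 0 ∧ s₄.N 17 (w ⟨q, hq⟩).1 ≤ 0 ∧ (w ⟨q, hq⟩).2 + 1 ≤ s₄.N 18 0) ↔
        ∀ p p' : Fin I.K, p < p' → p' < q + 1 →
          (w p).1 ≠ (w p').1 ∧ (w p').2 ≤ (w p).2 := by
      constructor
      · rintro ⟨h19, hz, hr⟩ p p' hpp' hp'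
        rcases Nat.lt_succ_iff_lt_or_eq.1 hp' with hp' | hp'
        · exact h₄.1.1 h19 p p' hpp' hp'
        · obtain rfl : p' = ⟨q, hq⟩ := Fin.ext hp'
          obtain ⟨h17, -, h18, -⟩ := h₄.2 h19
          refine ⟨fun h => ?_, ?_⟩
          · have := h17 p hpp'
            rw [h] at this
            omega
          · have := h18 p hpp'
            exact Fin.le_def.2 (by omega)
      · intro H
        have h19 := h₄.1.2 fun p p' hpp' hp' => H p p' hpp' (by omega)
        obtain ⟨h17, h17', h18, h18'⟩ := h₄.2 h19
        refine ⟨h19, (h17' _ fun p hp => (H p ⟨q, hq⟩ hp (by simp)).1).le, ?_⟩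
        rcases h18' with ⟨-, h18'⟩ | ⟨p, rfl, h18'⟩
        · have := (w ⟨q, hq⟩).2.is_lt
          omega
        · have := Fin.le_def.1 (H p ⟨p + 1, hq⟩ (Fin.lt_def.2 (by simp)) (by simp)).2
          omega
    have hsem : ∀ Q : State → Prop, (∀ s' : State,
        (1 ≤ s'.N 19 0 ↔ 1 ≤ s₄.N 19 0 ∧ s₄.N 17 (w ⟨q, hq⟩).1 ≤ 0 ∧
          (w ⟨q, hq⟩).2 + 1 ≤ s₄.N 18 0) →
        s'.N 17 = Function.update (s₄.N 17) (w ⟨q, hq⟩).1 ((w ⟨q, hq⟩).2 + 1) →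
        s'.N 18 0 = (w ⟨q, hq⟩).2 + 1 → Q s') → Runs _ s₄ 60 Q := fun Q hQ =>
      Runs.of_sem (p := setN 26 (.const 0) (.get 12 (.get 16 (.var 30))) ;;
        setN 27 (.const 0) (.add (.get 13 (.get 16 (.var 30))) (.const 1)) ;;
        ite (.and (.leN (.get 17 (.var 26)) (.const 0)) (.leN (.var 27) (.var 18))) skip
          (setN 19 (.const 0) (.const 0)) ;;
        setN 17 (.var 26) (.var 27) ;;
        setN 18 (.const 0) (.var 27)) 60 (by
        apply hQ
        · simp only [sem, NExp.eval, NExp.eval_var, BExp.leN_iff, BExp.and_iff, State.setN_N, hq₄, hw₄, e12, e13,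
            Function.update_self, if_true,
            Nat.reduceEqDiff, if_false]
          split_ifs with h
          · simp [h]
          · exact iff_of_false (by simp) fun h' => h h'.2
        all_goals
          simp only [sem, NExp.eval, NExp.eval_var, BExp.leN_iff, BExp.and_iff, State.setN_N, hq₄, hw₄, e12, e13,
            Function.update_self, if_true,
            Nat.reduceEqDiff, if_false]
          split_ifs <;> simp)
    refine hsem _ fun s' e19 e17 e18 => ⟨e19.trans key, fun h => ?_⟩
    rw [e19] at h
    have hcond := key.1 h
    obtain ⟨h17, h17', h18, -⟩ := h₄.2 h.1
    rw [e17, e18]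
    refine ⟨fun p hp => ?_, fun a ha => ?_, fun p hp => ?_, .inr ⟨⟨q, hq⟩, rfl, rfl⟩⟩
    · rcases Nat.lt_succ_iff_lt_or_eq.1 hp with hp | hp
      · rw [Function.update_of_ne, h17 p hp]
        rw [Ne, Fin.val_inj]
        exact (hcond p ⟨q, hq⟩ hp (by simp)).1
      · obtain rfl : p = ⟨q, hq⟩ := Fin.ext hp
        rw [Function.update_self]
    · rw [Function.update_of_ne, h17' a fun p hp => ha p (by omega)]
      rw [Ne, Fin.val_inj]
      exact fun h => ha ⟨q, hq⟩ (by simp) h.symm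
    · have := h18 p
      have := h.2.2
      rcases Nat.lt_succ_iff_lt_or_eq.1 hp with hp | hp
      · omega
      · obtain rfl : p = ⟨q, hq⟩ := Fin.ext hp
        exact le_rfl
  · refine ⟨h.1.trans ⟨fun H => ⟨fun p p' hpp' => ?_, fun p p' hpp' => ?_⟩, ?_⟩, fun h19 => ?_⟩
    · by_contra hne
      rcases lt_or_gt_of_ne hne with hlt | hlt
      · exact (H p p' hlt p'.is_lt).1 hpp'
      · exact (H p' p hlt p.is_lt).1 hpp'.symm
    · rcases hpp'.eq_or_lt with rfl | hlt
      · exact le_rfl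
      · exact (H p p' hlt p'.is_lt).2
    · exact fun H p p' hpp' _ => ⟨fun h => hpp'.ne (H.1 h), H.2 hpp'.le⟩
    · obtain ⟨h₁, h₂, h₃, h₄⟩ := h.2 h19
      refine ⟨fun p => h₁ p p.is_lt, fun a ha => h₂ a fun p _ => ha p, fun p => h₃ p p.is_lt, ?_⟩
      exact h₄.imp id fun ⟨p, _, hp⟩ => ⟨p, hp⟩

/-- The pairs that are allowed by the arrays `17` and `18`. -/
def allowed (I : Instance) (s : State) : Fin I.n → Fin I.n → Prop :=
  I.PairAllowed (s.N 17) (s.N 18 0)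

/-- The positions of the men in their lists. -/
def pos (I : Instance) (s : State) (i : Fin I.n) : ℕ := s.N 20 i

theorem runs_rejectTest {i : Fin I.n} (hT : Tables I s) (hi : s.N 31 0 = i)
    (hp : pos I s i < I.n) :
    Runs rejectTest s (I.n * 60 + 110) fun s' =>
      1 ≤ s'.N 22 0 ↔ I.Rejects (allowed I s) (pos I s) i := by
  set j := I.menList i ⟨pos I s i, hp⟩ with hj
  have e1 : s.N 1 (i * I.n + s.N 20 i) = j := hT.men i ⟨pos I s i, hp⟩
  refine Runs.le (Runs.seq (T₂ := 80 + (I.n * (40 + 13) + 10)) (Runs.of_sem 12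
    (Q := fun s' => s'.N 23 0 = j ∧ s'.N 31 0 = i) ?_) fun s₁ hk₁ h₁ => ?_) (by omega)
  · simp [sem, NExp.eval, hi, hT.base i (by omega), e1]
  have hT₁ := hT.of_keeps hk₁
  have e17 := hk₁.1 17 (by decide)
  have e18 := hk₁.1 18 (by decide)
  have e20 := hk₁.1 20 (by decide)
  have e2 : I.rkM i j = s.N 20 i + 1 := I.rkM_menList i ⟨pos I s i, hp⟩
  refine (Runs.of_sem 80 (Q := fun s' => 1 ≤ s'.N 22 0 ↔ ¬ allowed I s i j) ?_).seq
    fun s₂ hk₂ h₂ => ?_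
  · classical
    have : (sem (ite (.and (allowedTest (.var 31) (.add (.get 20 (.var 31)) (.const 1)))
        (allowedTest (.add (.var 0) (.var 23)) (.get 11 (.add (.get 9 (.var 23)) (.var 31)))))
        (setN 22 (.const 0) (.const 0)) (setN 22 (.const 0) (.const 1))) s₁).N 22 0 =
        if allowed I s i j then 0 else 1 := by
      simp only [sem, allowedTest, BExp.leN_iff, BExp.and_iff, NExp.eval, NExp.eval_var, h₁, hT₁.n, e17, e18, e20,
        hT₁.base j (by omega), hT₁.rkW, allowed, PairAllowed,
        RankAllowed, e2]
      split_ifs <;> simp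
    rw [this]
    split_ifs with h <;> simp [h]
  have hT₂ := hT₁.of_keeps hk₂
  have f23 : s₂.N 23 0 = j := by rw [hk₂.1 23 (by decide), h₁.1]
  have f31 : s₂.N 31 0 = i := by rw [hk₂.1 31 (by decide), h₁.2]
  have f20 : s₂.N 20 = s.N 20 := by rw [hk₂.1 20 (by decide), e20]
  refine (Runs.loop (T := 40) (Inv := fun q s' => 1 ≤ s'.N 22 0 ↔ ¬ allowed I s i j ∨
    ∃ i' : Fin I.n, i' < q ∧ I.rkM i' j ≤ pos I s i' + 1 ∧ I.rkW j i' < I.rkW j i) hT₂.n (by simp)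
    (by simpa using h₂) fun q hq s₃ hk₃ hq₃ h₃ => ?_).imp fun s' _ h => ?_
  · have hT₃ := hT₂.of_keeps hk₃
    have g23 : s₃.N 23 0 = j := by rw [hk₃.1 23 (by decide), f23]
    have g31 : s₃.N 31 0 = i := by rw [hk₃.1 31 (by decide), f31]
    have g20 : s₃.N 20 = s.N 20 := by rw [hk₃.1 20 (by decide), f20]
    have g10 := hT₃.rkM ⟨q, hq⟩ j
    have g11 := hT₃.rkW j ⟨q, hq⟩
    have g11' := hT₃.rkW j i
    refine Runs.of_sem 40 ?_
    simp only at g10 g11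
    simp only [sem, BExp.leN_iff, BExp.ltN_iff, BExp.and_iff, NExp.eval, NExp.eval_var, hq₃, g23, g31, g20,
      hT₃.base q (by omega), hT₃.base j (by omega), g10, g11, g11']
    have hstep : (∃ i' : Fin I.n, i' < q + 1 ∧ I.rkM i' j ≤ pos I s i' + 1 ∧
        I.rkW j i' < I.rkW j i) ↔ (∃ i' : Fin I.n, i' < q ∧ I.rkM i' j ≤ pos I s i' + 1 ∧
        I.rkW j i' < I.rkW j i) ∨ (I.rkM ⟨q, hq⟩ j ≤ s.N 20 q + 1 ∧
        I.rkW j ⟨q, hq⟩ < I.rkW j i) := by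
      constructor
      · rintro ⟨i', hi', h⟩
        rcases Nat.lt_succ_iff_lt_or_eq.1 hi' with hi' | rfl
        · exact .inl ⟨i', hi', h⟩
        · exact .inr h
      · rintro (⟨i', hi', h⟩ | h)
        · exact ⟨i', by omega, h⟩
        · exact ⟨⟨q, hq⟩, by simp, h⟩
    rw [hstep, ← or_assoc]
    split_ifs with h
    · simp [h]
    · rw [h₃]
      simp only [h, or_false]
  · rw [h]
    constructor
    · rintro (h | ⟨i', -, h⟩)
      · exact ⟨hp, .inl h⟩
      · exact ⟨hp, .inr ⟨i', h⟩⟩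
    · rintro ⟨_, h | ⟨i', h⟩⟩
      · exact .inl h
      · exact .inr ⟨i', i'.is_lt, h⟩

/-- A round without rejection tests all men against the same positions and so certifies that none is
rejected. Any other round increases the sum of the positions. -/
theorem runs_round (hT : Tables I s) (hsafe : I.Safe (allowed I s) (pos I s))
    (hle : ∀ i, pos I s i ≤ I.n) :
    Runs round s (I.n * (I.n * 60 + 180) + 20) fun s' =>
      I.Safe (allowed I s) (pos I s') ∧ (∀ i, pos I s' i ≤ I.n) ∧
        ((s'.N 21 0 = 0 ∧ ∀ i, ¬ I.Rejects (allowed I s) (pos I s') i) ∨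
          (s'.N 21 0 = 1 ∧ ∑ i, pos I s i < ∑ i, pos I s' i)) := by
  refine Runs.le (Runs.seq (T₂ := I.n * (I.n * 60 + 167 + 13) + 10) (Runs.of_sem 4
    (Q := fun s' => s'.N 21 0 = 0) (by simp [sem, NExp.eval])) fun s₁ hk₁ h₁ => ?_) (by linarith)
  have hT₁ := hT.of_keeps hk₁
  have hpos₁ : pos I s₁ = pos I s := by
    funext i
    rw [pos, pos, hk₁.1 20 (by decide)]
  refine (Runs.loop (T := I.n * 60 + 167) (Inv := fun q s' =>
    I.Safe (allowed I s) (pos I s') ∧ (∀ i, pos I s' i ≤ I.n) ∧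
      ((s'.N 21 0 = 0 ∧ pos I s' = pos I s ∧
        ∀ i : Fin I.n, i < q → ¬ I.Rejects (allowed I s) (pos I s') i) ∨
      (s'.N 21 0 = 1 ∧ ∑ i, pos I s i < ∑ i, pos I s' i))) hT₁.n (fun i s' x h => ?_) ?_
    fun q hq s₂ hk₂ hq₂ h₂ => ?_).imp fun s' _ h => ?_
  · have : pos I (s'.setN 31 0 x) = pos I s' := rfl
    simpa [this] using h
  · rw [hpos₁]
    exact ⟨hsafe, hle, .inl ⟨h₁, rfl, by simp⟩⟩
  · have hT₂ := hT₁.of_keeps hk₂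
    obtain ⟨hsafe₂, hle₂, hcase⟩ := h₂
    have hall : allowed I s₂ = allowed I s := by
      rw [allowed, allowed, hk₂.1 17 (by decide), hk₂.1 18 (by decide), hk₁.1 17 (by decide),
        hk₁.1 18 (by decide)]
    refine Runs.le (Runs.ite (T := I.n * 60 + 110 + 30) (fun hc => ?_) fun hc => ?_)
      (show 7 + (I.n * 60 + 110 + 30) + 1 ≤ I.n * 60 + 167 by omega)
    · have hlt : pos I s₂ ⟨q, hq⟩ < I.n := by
        simpa [NExp.eval, hq₂, hT₂.n, pos] using hc
      refine (runs_rejectTest hT₂ (i := ⟨q, hq⟩) hq₂ hlt).seq fun s₃ hk₃ h₃ => ?_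
      rw [hall] at h₃
      have e20 := hk₃.1 20 (by decide)
      have e31 : s₃.N 31 0 = q := by rw [hk₃.1 31 (by decide), hq₂]
      have e21 : s₃.N 21 = s₂.N 21 := hk₃.1 21 (by decide)
      refine Runs.of_sem 30 ?_
      by_cases hrej : I.Rejects (allowed I s) (pos I s₂) ⟨q, hq⟩
      · have hupd (s' : State) (h : s'.N 20 = Function.update (s₂.N 20) q (s₂.N 20 q + 1)) :
            pos I s' = Function.update (pos I s₂) ⟨q, hq⟩ (pos I s₂ ⟨q, hq⟩ + 1) := by
          funext i
          simp only [pos, h, Function.update_apply, Fin.ext_iff]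
        set s' := sem (ite (.leN (.const 1) (.var 22))
          (setN 20 (.var 31) (.add (.get 20 (.var 31)) (.const 1)) ;;
            setN 21 (.const 0) (.const 1)) skip) s₃ with hs'
        have h' : s' = (s₃.setN 20 q (s₂.N 20 q + 1)).setN 21 0 1 := by
          simp [hs', sem, BExp.leN_iff, NExp.eval, h₃, hrej, e31, e20]
        have hp' := hupd s' (by simp [h', e20])
        have hsum : ∑ i, pos I s' i = ∑ i, pos I s₂ i + 1 := by
          rw [hp', Finset.sum_update_of_mem (Finset.mem_univ _),
            Finset.sum_eq_add_sum_sdiff_singleton_of_mem (Finset.mem_univ (⟨q, hq⟩ : Fin I.n))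
              (pos I s₂)]
          ring
        refine ⟨?_, fun i => ?_, .inr ⟨by simp [h'], ?_⟩⟩
        · rw [hp']
          exact hsafe₂.update hrej
        · rw [hp', Function.update_apply]
          split_ifs
          · exact hlt
          · exact hle₂ i
        · rw [hsum]
          rcases hcase with ⟨-, hp, -⟩ | ⟨-, hp⟩
          · rw [hp]
            exact Nat.lt_succ_self _
          · omega
      · have h' : sem (ite (.leN (.const 1) (.var 22))
          (setN 20 (.var 31) (.add (.get 20 (.var 31)) (.const 1)) ;;
            setN 21 (.const 0) (.const 1)) skip) s₃ = s₃ := by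
          simp only [sem, BExp.leN_iff, NExp.eval, NExp.eval_var, h₃, hrej]
          simp
        rw [h']
        have hp' : pos I s₃ = pos I s₂ := by
          funext i
          rw [pos, pos, e20]
        rw [hp', e21]
        refine ⟨hsafe₂, hle₂, hcase.imp (fun ⟨h21, hp, h⟩ => ⟨h21, hp, fun i hi => ?_⟩) id⟩
        rcases Nat.lt_succ_iff_lt_or_eq.1 hi with hi | rfl
        · exact h i hi
        · exact hrej
    -- A man at the end of his list is skipped; `Rejects` does not apply to him by definition.
    · refine Runs.of_sem (I.n * 60 + 110 + 30) ?_ (by decide) (show 1 ≤ I.n * 60 + 110 + 30 by omega)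
      refine ⟨hsafe₂, hle₂, hcase.imp (fun ⟨h21, hp, h⟩ => ⟨h21, hp, fun i hi => ?_⟩) id⟩
      rcases Nat.lt_succ_iff_lt_or_eq.1 hi with hi | rfl
      · exact h i hi
      · rintro ⟨hlt, -⟩
        have : ¬ pos I s₂ i < I.n := by
          simpa [NExp.eval, hq₂, hT₂.n, pos] using hc
        exact this hlt
  · exact ⟨h.1, h.2.1, h.2.2.imp (fun h => ⟨h.1, fun i => h.2.2 i i.is_lt⟩) id⟩

/-- The positions sum to at most `n * n`, so there are at most `n * n + 1` rounds, the last one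
without rejection. A round costs `O(n ^ 2)`, which gives `O(n ^ 4)`. -/
theorem runs_propose (hT : Tables I s) (h19 : 1 ≤ s.N 19 0) :
    Runs propose s ((I.n * I.n + 2) * (I.n * (I.n * 60 + 180) + 40) + I.n * 80 + 60) fun s' =>
      (1 ≤ s'.N 19 0 ∧ ∃ x : I.Marriage, I.IsStable x ∧ (∀ i, allowed I s i (x i)) ∧
        ∀ i : Fin I.n, s'.N 1 (i * I.n + s'.N 20 i) = x i) ∨
      (s'.N 19 0 = 0 ∧ ¬ ∃ x : I.Marriage, I.IsStable x ∧ ∀ i, allowed I s i (x i)) := by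
  refine Runs.le (Runs.seq (T₂ := 4 + ((I.n * I.n + 1) * (4 + (I.n * (I.n * 60 + 180) + 20) + 1) +
    (4 + 1) + (I.n * (20 + 13) + 10))) (Runs.loop (T := 5)
    (Inv := fun i s' => ∀ a < i, s'.N 20 a = 0) hT.n (by simp) (by simp)
    fun i hi s₁ hk₁ hi₁ h₁ => Runs.of_sem 5 ?_) fun s₁ hk₁ h₁ => ?_) ?_
  rotate_right
  · generalize I.n * (I.n * 60 + 180) = X
    generalize I.n * I.n = m
    linarith
  · intro a ha
    simp only [sem, NExp.eval, NExp.eval_var, State.setN_N, hi₁, if_true, Function.update_apply]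
    split_ifs
    · rfl
    · exact h₁ a (by omega)
  have hT₁ := hT.of_keeps hk₁
  refine (Runs.of_sem 4 (Q := fun s' => s'.N 20 = s₁.N 20 ∧ s'.N 21 0 = 1)
    (by simp [sem, NExp.eval])).seq fun s₂ hk₂ h₂ => ?_
  have hT₂ := hT₁.of_keeps hk₂
  have hall₂ : allowed I s₂ = allowed I s := by
    rw [allowed, allowed, hk₂.1 17 (by decide), hk₂.1 18 (by decide), hk₁.1 17 (by decide),
      hk₁.1 18 (by decide)]
  have hpos₂ : pos I s₂ = fun _ => 0 := by
    funext i
    rw [pos, h₂.1, h₁ i i.is_lt]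
  refine Runs.seq (R := fun s' => I.Safe (allowed I s) (pos I s') ∧
    ∀ i, ¬ I.Rejects (allowed I s) (pos I s') i) (Runs.whileLoop
    (T := I.n * (I.n * 60 + 180) + 20) (fun k s' => Keeps round s₂ s' ∧
      I.Safe (allowed I s) (pos I s') ∧ (∀ i, pos I s' i ≤ I.n) ∧
      ((s'.N 21 0 = 1 ∧ k = I.n * I.n + 1 - ∑ i, pos I s' i) ∨
        (s'.N 21 0 = 0 ∧ k = 0 ∧ ∀ i, ¬ I.Rejects (allowed I s) (pos I s') i)))
    (fun k s₃ h₃ => ?_) (I.n * I.n + 1) s₂ ?_) fun s₃ hk₃ h₃ => ?_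
  · obtain ⟨hk₃, hsafe, hle, ⟨h21, hk⟩ | ⟨h21, -, h⟩⟩ := h₃
    · right
      refine ⟨by simp [NExp.eval, h21], ?_⟩
      have hT₃ := hT₂.of_keeps hk₃
      have hall₃ : allowed I s₃ = allowed I s := by
        rw [← hall₂, allowed, allowed, hk₃.1 17 (by decide), hk₃.1 18 (by decide)]
      have hsum : ∑ i, pos I s₃ i ≤ I.n * I.n := by
        simpa using Finset.sum_le_card_nsmul Finset.univ (pos I s₃) I.n fun i _ => hle i
      refine (runs_round hT₃ (by rwa [hall₃]) hle).imp fun s₄ hk₄ ⟨hsafe₄, hle₄, h₄⟩ => ?_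
      rw [hall₃] at hsafe₄ h₄
      rcases h₄ with ⟨h21', hrej⟩ | ⟨h21', hlt⟩
      · exact ⟨0, by omega, hk₃.trans hk₄, hsafe₄, hle₄, .inr ⟨h21', rfl, hrej⟩⟩
      · exact ⟨_, by omega, hk₃.trans hk₄, hsafe₄, hle₄, .inl ⟨h21', rfl⟩⟩
    · left
      exact ⟨by simp [NExp.eval, h21], hsafe, h⟩
  · refine ⟨.refl _ _, ?_, ?_, .inl ⟨h₂.2, ?_⟩⟩
    · rw [hpos₂]
      exact safe_zero
    · simp [hpos₂]
    · simp [hpos₂]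
  have hT₃ := hT₂.of_keeps hk₃
  have e19 : 1 ≤ s₃.N 19 0 := by
    rwa [hk₃.1 19 (by decide), hk₂.1 19 (by decide), hk₁.1 19 (by decide)]
  refine (Runs.loop (T := 20) (Inv := fun q s' =>
    (1 ≤ s'.N 19 0 ∧ ∀ i : Fin I.n, i < q → pos I s₃ i < I.n) ∨
    (s'.N 19 0 = 0 ∧ ∃ i : Fin I.n, I.n ≤ pos I s₃ i)) hT₃.n (by simp)
    (by simp [e19]) fun q hq s₄ hk₄ hq₄ h₄ => ?_).imp fun s' hk' h => ?_
  · have hT₄ := hT₃.of_keeps hk₄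
    have e20 : s₄.N 20 q = pos I s₃ ⟨q, hq⟩ := by rw [hk₄.1 20 (by decide)]; rfl
    refine Runs.of_sem 20 ?_
    simp only [sem, BExp.ltN_iff, NExp.eval, NExp.eval_var, hq₄, e20, hT₄.n]
    split_ifs with hlt
    · refine h₄.imp (fun ⟨h, h'⟩ => ⟨h, fun i hi => ?_⟩) id
      rcases Nat.lt_succ_iff_lt_or_eq.1 hi with hi | rfl
      · exact h' i hi
      · exact hlt
    · exact .inr ⟨by simp, _, not_lt.1 hlt⟩
  · have e20 : s'.N 20 = s₃.N 20 := hk'.1 20 (by decide)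
    rcases h with ⟨h, hlt⟩ | ⟨h, i, hi⟩
    · left
      obtain ⟨x, hx, hst, hA⟩ := exists_stable_of_forall_not_rejects h₃.2 fun i => hlt i i.is_lt
      refine ⟨h, x, hst, hA, fun i => ?_⟩
      rw [e20, hx]
      exact (hT₃.of_keeps hk').men i ⟨pos I s₃ i, hlt i i.is_lt⟩
    · right
      refine ⟨h, fun ⟨x, hst, hA⟩ => ?_⟩
      -- Safety puts the rank of the partner above `n`.
      have h₄ := h₃.1 x hst hA i
      have h₅ : I.rkM i (x i) ≤ I.n := Nat.succ_le_of_lt (Fin.is_lt _)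
      omega

end GGISM

/-! ## Verification of the enumeration -/

namespace GGISM

open RAM RAM.Prog Instance

variable {I : Instance} {s : State}

/-- Adding one in base `B`: after `q` digits the carry is still set exactly when `B ^ q` divides `t
+ 1`. A carry out of all digits signals that the last word has been treated. -/
theorem runs_nextWord {t : ℕ} (hT : Tables I s)
    (hdig : ∀ p < I.K, s.N 16 p = t / ((I.n + I.n) * I.n) ^ p % ((I.n + I.n) * I.n)) :
    Runs nextWord s (I.n * 150 + 20) fun s' =>
      (∀ p < I.K, s'.N 16 p = (t + 1) / ((I.n + I.n) * I.n) ^ p % ((I.n + I.n) * I.n)) ∧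
      ((s'.N 25 0 = 1 ∧ ((I.n + I.n) * I.n) ^ I.K ∣ t + 1) ∨
        (s'.N 25 0 = 0 ∧ ¬ ((I.n + I.n) * I.n) ^ I.K ∣ t + 1)) := by
  have hK := I.K_le
  have hcard := hT.card
  have hB : 0 < (I.n + I.n) * I.n := Nat.mul_pos (by have := I.n_pos; omega) I.n_pos
  generalize (I.n + I.n) * I.n = B at hdig hcard hB ⊢
  refine Runs.le (Runs.seq (T₂ := I.K * (50 + 13) + 10) (Runs.of_sem 4
    (Q := fun s' => s'.N 25 0 = 1) (by simp [sem, NExp.eval])) fun s₁ hk₁ h₁ => ?_) (by omega)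
  have hT₁ := hT.of_keeps hk₁
  refine (Runs.loop (T := 50) (Inv := fun q s' =>
    (∀ p < q, s'.N 16 p = (t + 1) / B ^ p % B) ∧
    (∀ p, q ≤ p → p < I.K → s'.N 16 p = t / B ^ p % B) ∧
    ((s'.N 25 0 = 1 ∧ B ^ q ∣ t + 1) ∨ (s'.N 25 0 = 0 ∧ ¬ B ^ q ∣ t + 1))) hT₁.K (by simp)
    ?_ fun q hq s₂ hk₂ hq₂ h₂ => ?_).imp fun s' _ h => ⟨h.1, h.2.2⟩
  · refine ⟨by simp, fun p _ hp => ?_, .inl ⟨h₁, by simp⟩⟩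
    rw [hk₁.1 16 (by decide), hdig p hp]
  · obtain ⟨hlt, hge, hc⟩ := h₂
    have h14 : s₂.N 14 0 = B := by rw [hk₂.1 14 (by decide), hk₁.1 14 (by decide), hcard]
    have hq16 := hge q le_rfl hq
    have hdiv : B ^ (q + 1) ∣ t + 1 ↔ B ^ q ∣ t + 1 ∧ B ∣ (t + 1) / B ^ q := by
      constructor
      · intro h
        have h' : B ^ q ∣ t + 1 := (pow_dvd_pow B (Nat.le_succ q)).trans h
        exact ⟨h', (Nat.dvd_div_iff_mul_dvd h').2 (by rwa [← pow_succ])⟩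
      · rintro ⟨h, h'⟩
        rw [pow_succ]
        exact (Nat.dvd_div_iff_mul_dvd h).1 h'
    refine Runs.of_sem 50 ?_
    simp only [sem, BExp.leN_iff, BExp.ltN_iff, NExp.eval, NExp.eval_var, hq₂, h14, hq16,
      ]
    rcases hc with ⟨hc, hd⟩ | ⟨hc, hd⟩
    · have hsucc : (t + 1) / B ^ q = t / B ^ q + 1 := by rw [Nat.succ_div, if_pos hd]
      rw [if_pos hc.ge]
      split_ifs with hm
      · have hmod : (t / B ^ q + 1) % B = t / B ^ q % B + 1 := by
          rw [← Nat.mod_add_mod, Nat.mod_eq_of_lt hm]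
        refine ⟨fun p hp => ?_, fun p hp hpK => ?_, .inr ⟨by simp, ?_⟩⟩
        · rcases Nat.lt_succ_iff_lt_or_eq.1 hp with hp | rfl
          · simpa [Function.update_of_ne hp.ne] using hlt p hp
          · simp [hsucc, hmod]
        · simpa [Function.update_of_ne (show p ≠ q by omega)] using hge p (by omega) hpK
        · rw [hdiv, hsucc]
          rintro ⟨-, h⟩
          have := Nat.mod_eq_zero_of_dvd h
          omega
      · have hmod : t / B ^ q % B + 1 = B := by
          have := Nat.mod_lt (t / B ^ q) hB
          omega
        have hmod' : (t / B ^ q + 1) % B = 0 := by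
          rw [← Nat.mod_add_mod, hmod, Nat.mod_self]
        refine ⟨fun p hp => ?_, fun p hp hpK => ?_, .inl ⟨by simpa using hc, ?_⟩⟩
        · rcases Nat.lt_succ_iff_lt_or_eq.1 hp with hp | rfl
          · simpa [Function.update_of_ne hp.ne] using hlt p hp
          · simp [hsucc, hmod']
        · simpa [Function.update_of_ne (show p ≠ q by omega)] using hge p (by omega) hpK
        · rw [hdiv, hsucc]
          exact ⟨hd, Nat.dvd_of_mod_eq_zero hmod'⟩
    · have hsucc : (t + 1) / B ^ q = t / B ^ q := by rw [Nat.succ_div, if_neg hd, add_zero]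
      rw [if_neg (by omega)]
      refine ⟨fun p hp => ?_, fun p hp hpK => hge p (by omega) hpK, .inr ⟨hc, ?_⟩⟩
      · rcases Nat.lt_succ_iff_lt_or_eq.1 hp with hp | rfl
        · exact hlt p hp
        · rw [hq16, hsucc]
      · exact fun h => hd (hdiv.1 h).1

/-- The value of a marriage with the top agents `w`. -/
def wordValue (w : Fin I.K → Fin (I.n + I.n) × Fin I.n) : ℚ :=
  ∑ p, (I.weight (Fin.castLE I.K_le p) : ℚ) * I.disutility ((w p).2 + 1)

/-- A digit of a word is itself the cell of the partner in the men's lists, and for a woman,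
numbered from `n`, it is too large by `n * n`. -/
theorem Tables.mate_eq (hT : Tables I s) (a : Fin (I.n + I.n)) (k : Fin I.n) :
    (if (a : ℕ) < I.n then I.n + s.N 1 (a * I.n + k) else s.N 2 (a * I.n + k - I.n * I.n)) =
      I.mate a k := by
  induction a using Fin.addCases with
  | left i => simp [mate, hT.men, -Fin.natAdd_eq_addNat]
  | right j =>
    have : (I.n + j) * I.n + (k : ℕ) - I.n * I.n = j * I.n + k := by
      rw [add_mul, add_assoc, Nat.add_sub_cancel_left]
    simp [mate, this, hT.women, -Fin.natAdd_eq_addNat]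

theorem runs_emit {w : Fin I.K → Fin (I.n + I.n) × Fin I.n} (hT : Tables I s)
    (hw : HasWord w s) :
    Runs emit s (I.n * 300 + 20) fun s' =>
      s'.N 24 0 = s.N 24 0 + I.K ∧ s'.Q 4 0 = wordValue w ∧
      (∀ i < s.N 24 0, s'.Q 3 i = s.Q 3 i ∧ s'.N 5 i = s.N 5 i ∧ s'.N 6 i = s.N 6 i) ∧
      ∀ p : Fin I.K, s'.Q 3 (s.N 24 0 + p) = I.disutility ((w p).2 + 1) ∧
        s'.N 5 (s.N 24 0 + p) = (w p).1 ∧ s'.N 6 (s.N 24 0 + p) = I.mate (w p).1 (w p).2 := by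
  have hK := I.K_le
  -- The summands are extended by `0` so that partial sums over `range q` can serve as loop
  -- invariant.
  let f : ℕ → ℚ := fun i => if h : i < I.K then
    (I.weight (Fin.castLE hK ⟨i, h⟩) : ℚ) * I.disutility ((w ⟨i, h⟩).2 + 1) else 0
  have hf : wordValue w = ∑ i ∈ Finset.range I.K, f i := by
    rw [Finset.sum_range, wordValue]
    exact Finset.sum_congr rfl fun p _ => by
      simp only [f]
      rw [dif_pos p.is_lt]
  rw [hf]
  refine Runs.le (Runs.seq (T₂ := I.K * (130 + 13) + 10) (Runs.of_sem 4
    (Q := fun s' => s'.N = s.N ∧ s'.Q 4 0 = 0 ∧ s'.Q 3 = s.Q 3)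
    ⟨rfl, by simp [sem, NExp.eval, QExp.eval], by simp [sem]⟩) fun s₁ hk₁ h₁ => ?_) (by omega)
  have hT₁ := hT.of_keeps hk₁
  refine (Runs.loop (T := 130) (Inv := fun q s' =>
    s'.N 24 0 = s.N 24 0 + q ∧ s'.Q 4 0 = ∑ i ∈ Finset.range q, f i ∧
    (∀ i < s.N 24 0, s'.Q 3 i = s.Q 3 i ∧ s'.N 5 i = s.N 5 i ∧ s'.N 6 i = s.N 6 i) ∧
    ∀ p : Fin I.K, p < q → s'.Q 3 (s.N 24 0 + p) = I.disutility ((w p).2 + 1) ∧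
      s'.N 5 (s.N 24 0 + p) = (w p).1 ∧ s'.N 6 (s.N 24 0 + p) = I.mate (w p).1 (w p).2)
    hT₁.K (by simp) ⟨by rw [h₁.1, add_zero], by simp [h₁.2.1], by simp [h₁.1, h₁.2.2], by simp⟩
    fun q hq s₂ hk₂ hq₂ h₂ => ?_).imp fun s' _ h => ⟨h.1, h.2.1, h.2.2.1, fun p => h.2.2.2 p p.is_lt⟩
  have hT₂ := hT₁.of_keeps hk₂
  have hw₂ : s₂.N 16 q = (w ⟨q, hq⟩).1 * I.n + (w ⟨q, hq⟩).2 := by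
    rw [hk₂.1 16 (by decide), hk₁.1 16 (by decide)]
    exact hw ⟨q, hq⟩
  obtain ⟨e12, e13⟩ := hT₂.digit_eq (w ⟨q, hq⟩).1 (w ⟨q, hq⟩).2
  have hmate := hT₂.mate_eq (w ⟨q, hq⟩).1 (w ⟨q, hq⟩).2
  have hdis := hT₂.dis (w ⟨q, hq⟩).2
  have hwt : s₂.Q 1 q = I.weight (Fin.castLE hK ⟨q, hq⟩) := hT₂.weight (Fin.castLE hK ⟨q, hq⟩)
  have hfq : f q = (I.weight (Fin.castLE hK ⟨q, hq⟩) : ℚ) * I.disutility ((w ⟨q, hq⟩).2 + 1) :=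
    dif_pos hq
  obtain ⟨h24, h4, hold, hnew⟩ := h₂
  have hn := hT₂.n
  have h9 := hT₂.base I.n (by omega)
  generalize hr : s.N 24 0 = o at *
  generalize (w ⟨q, hq⟩).1 * I.n + ((w ⟨q, hq⟩).2 : ℕ) = e at *
  refine Runs.of_sem 130 ?_
  set s' := sem _ s₂ with hs'
  have hs6 : s'.N 6 = Function.update (s₂.N 6) (o + q) (I.mate (w ⟨q, hq⟩).1 (w ⟨q, hq⟩).2) := by
    rw [hs', ← hmate]
    simp only [sem, NExp.eval, NExp.eval_var, BExp.ltN_iff, State.setN_N, State.setQ_N, hq₂, hw₂,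
      e12, hn, h9, h24, Function.update_self, Nat.reduceEqDiff, if_false,
      if_true]
    split_ifs <;> simp []
  have hs5 : s'.N 5 = Function.update (s₂.N 5) (o + q) (w ⟨q, hq⟩).1 := by
    simp only [hs', sem, NExp.eval, NExp.eval_var, BExp.ltN_iff, State.setN_N, State.setQ_N, hq₂,
      hw₂, e12, hn, h9, h24, Function.update_self, Nat.reduceEqDiff, if_false,
      if_true]
    split_ifs <;> simp []
  have hs24 : s'.N 24 0 = o + q + 1 := by
    simp only [hs', sem, NExp.eval, NExp.eval_var, BExp.ltN_iff, State.setN_N, State.setQ_N, hq₂,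
      hw₂, e12, hn, h9, h24, Function.update_self, Nat.reduceEqDiff, if_false,
      if_true]
    split_ifs <;> simp [h24]
  have hs3 : s'.Q 3 = Function.update (s₂.Q 3) (o + q) (I.disutility ((w ⟨q, hq⟩).2 + 1)) := by
    simp only [hs', sem, NExp.eval, NExp.eval_var, BExp.ltN_iff, State.setN_N, State.setQ_N, hq₂,
      hw₂, e12, e13, hn, h9, h24, Function.update_self, Nat.reduceEqDiff,
      if_false, if_true, QExp.eval, State.setQ_Q, State.setN_Q, hdis]
    split_ifs <;> simp []
  have hs4 : s'.Q 4 0 = ∑ i ∈ Finset.range (q + 1), f i := by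
    rw [Finset.sum_range_succ, ← h4, hfq, ← hdis, ← hwt]
    simp only [hs', sem, NExp.eval, NExp.eval_var, BExp.ltN_iff, State.setN_N, State.setQ_N, hq₂,
      hw₂, e12, e13, hn, h9, h24, Function.update_self, Nat.reduceEqDiff,
      if_false, if_true, QExp.eval, State.setQ_Q, State.setN_Q, hdis]
    split_ifs <;> simp []
  rw [hs24, hs3, hs4, hs5, hs6]
  refine ⟨by omega, rfl, fun i hi => ?_, fun p hp => ?_⟩
  · simp only [Function.update_of_ne (show i ≠ o + q by omega)]
    exact hold i hi
  · rcases Nat.lt_succ_iff_lt_or_eq.1 hp with hp | hp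
    · simp only [Function.update_of_ne (show o + (p : ℕ) ≠ o + q by omega)]
      exact hnew p hp
    · obtain rfl : p = ⟨q, hq⟩ := Fin.ext hp
      simp only [Function.update_self, and_self]

theorem runs_update {x : I.Marriage} (hT : Tables I s)
    (hx : ∀ i : Fin I.n, s.N 1 (i * I.n + s.N 20 i) = x i) :
    Runs update s (I.n * 60 + 60) fun s' =>
      s'.N 4 0 = s.N 4 0 + 1 ∧
      ((s.N 4 0 ≠ 0 ∧ s.Q 5 0 ≤ s.Q 4 0 ∧ s'.Q 5 0 = s.Q 5 0 ∧ s'.N 3 = s.N 3) ∨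
        ((s.N 4 0 ≠ 0 → s.Q 4 0 ≤ s.Q 5 0) ∧ s'.Q 5 0 = s.Q 4 0 ∧
          ∀ i : Fin I.n, s'.N 3 i = x i)) := by
  refine Runs.le (Runs.seq (T₂ := 6) (R := fun s' => s'.N 4 = s.N 4 ∧
      ((s.N 4 0 ≠ 0 ∧ s.Q 5 0 ≤ s.Q 4 0 ∧ s'.Q 5 0 = s.Q 5 0 ∧ s'.N 3 = s.N 3) ∨
        ((s.N 4 0 ≠ 0 → s.Q 4 0 ≤ s.Q 5 0) ∧ s'.Q 5 0 = s.Q 4 0 ∧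
          ∀ i : Fin I.n, s'.N 3 i = x i)))
    (Runs.ite (T := 4 + (I.n * (20 + 13) + 10)) (fun hc => ?_) fun hc => ?_)
    fun s₁ hk₁ h₁ => Runs.of_sem 6 ?_)
    (show 10 + (4 + (I.n * (20 + 13) + 10)) + 1 + 6 ≤ _ by omega)
  · refine Runs.of_sem (4 + (I.n * (20 + 13) + 10)) ⟨rfl, .inl ?_⟩ (by decide)
      (show 1 ≤ 4 + (I.n * (20 + 13) + 10) by omega)
    simp only [BExp.leN_iff, BExp.leQ_iff, BExp.and_iff, NExp.eval, NExp.eval_var, QExp.eval] at hc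
    exact ⟨by omega, hc.2, rfl, rfl⟩
  · have hc' : s.N 4 0 ≠ 0 → s.Q 4 0 ≤ s.Q 5 0 := by
      simp only [BExp.leN_iff, BExp.leQ_iff, BExp.and_iff, NExp.eval, NExp.eval_var, QExp.eval, not_and_or
        ] at hc
      intro h
      rcases hc with hc | hc
      · omega
      · exact (not_le.1 hc).le
    refine (Runs.of_sem 4 (Q := fun s' => s'.N = s.N ∧ s'.Q 5 0 = s.Q 4 0)
      ⟨rfl, by simp [sem, NExp.eval, QExp.eval]⟩).seq fun s₁ hk₁ h₁ => ?_
    have hT₁ := hT.of_keeps hk₁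
    refine (Runs.loop (T := 20) (Inv := fun q s' => ∀ i : Fin I.n, i < q → s'.N 3 i = x i) hT₁.n
      (by simp) (by simp) fun q hq s₂ hk₂ hq₂ h₂ => ?_).imp fun s₂ hk₂ h₂ => ?_
    · have hT₂ := hT₁.of_keeps hk₂
      have hx₂ := hx ⟨q, hq⟩
      rw [← h₁.1, ← hk₂.1 1 (by decide), ← hk₂.1 20 (by decide)] at hx₂
      simp only at hx₂
      refine Runs.of_sem 20 fun i hi => ?_
      simp only [sem, NExp.eval, NExp.eval_var, State.setN_N, hq₂, hT₂.base q (by omega), hx₂,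
        if_true, Function.update_apply]
      split_ifs with h
      · obtain rfl : i = ⟨q, hq⟩ := Fin.ext h
        rfl
      · exact h₂ i (by omega)
    · refine ⟨by rw [hk₂.1 4 (by decide), h₁.1], .inr ⟨hc', ?_, fun i => h₂ i i.is_lt⟩⟩
      rw [hk₂.2 5 (by decide), h₁.2]
  · obtain ⟨h4, h⟩ := h₁
    simpa [sem, NExp.eval, h4] using h

/-- The word with number `u` is formed by the top agents of a stable marriage. -/
def Feasible (I : Instance) (u : Fin (((I.n + I.n) * I.n) ^ I.K)) : Prop :=
  ∃ x : I.Marriage, I.IsStable x ∧ I.IsTop (I.word I.K u) x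

/-- The words with numbers less than `t` have been treated, and those in the list `L` have been found
to be feasible. -/
structure Progress (I : Instance) (t : ℕ) (L : List (Fin (((I.n + I.n) * I.n) ^ I.K)))
    (s : State) : Prop where
  nodup : L.Nodup
  mem_iff (u) : u ∈ L ↔ (u : ℕ) < t ∧ Feasible I u
  count : s.N 4 0 = L.length
  free : s.N 24 0 = L.length * I.K
  out (j u) : L[j]? = some u → ∀ p : Fin I.K,
    s.Q 3 (j * I.K + p) = I.disutility ((I.word I.K u p).2 + 1) ∧
    s.N 5 (j * I.K + p) = (I.word I.K u p).1 ∧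
    s.N 6 (j * I.K + p) = I.mate (I.word I.K u p).1 (I.word I.K u p).2
  best : L ≠ [] → ∃ x : I.Marriage, I.IsStable x ∧ s.Q 5 0 = I.value x ∧
    (∀ i : Fin I.n, s.N 3 i = x i) ∧ ∀ u ∈ L, s.Q 5 0 ≤ wordValue (I.word I.K u)

/-- Does the program leave the arrays with results unchanged? -/
def keepsResults (p : Prog) : Bool :=
  [3, 4, 5, 6, 24].all (fun a => !p.writesN a) && [3, 5].all fun a => !p.writesQ a

section Progress

variable {t : ℕ} {L : List (Fin (((I.n + I.n) * I.n) ^ I.K))} {s' : State}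

theorem Progress.of_keeps {p : Prog} (h : Progress I t L s) (hk : Keeps p s s')
    (hp : keepsResults p = true := by decide) : Progress I t L s' := by
  simp only [keepsResults, List.all_cons, List.all_nil, Bool.and_true, Bool.and_eq_true,
    Bool.not_eq_true'] at hp
  obtain ⟨⟨e3, e4, e5, e6, e24⟩, q3, q5⟩ := hp
  have hN := hk.1
  have hQ := hk.2
  refine ⟨h.nodup, h.mem_iff, ?_, ?_, ?_, ?_⟩ <;>
    simp only [hN _ e3, hN _ e4, hN _ e5, hN _ e6, hN _ e24, hQ _ q3, hQ _ q5]
  exacts [h.count, h.free, h.out, h.best]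

theorem Progress.skip (h : Progress I t L s) (ht : t < ((I.n + I.n) * I.n) ^ I.K)
    (hf : ¬ Feasible I ⟨t, ht⟩) : Progress I (t + 1) L s := by
  refine ⟨h.nodup, fun u => ?_, h.count, h.free, h.out, h.best⟩
  rw [h.mem_iff]
  refine ⟨fun h => ⟨by omega, h.2⟩, fun ⟨hu, hfu⟩ => ⟨lt_of_le_of_ne (by omega) ?_, hfu⟩⟩
  rintro rfl
  exact hf hfu

/-- The value computed from the word is the value of the marriage found, so comparing words compares
marriages. The number `t` is new to the list because all earlier entries are smaller. -/
theorem runs_emit_update (h : Progress I t L s) (ht : t < ((I.n + I.n) * I.n) ^ I.K)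
    (hT : Tables I s) (hw : HasWord (I.word I.K ⟨t, ht⟩) s) {x : I.Marriage}
    (hst : I.IsStable x) (htop : I.IsTop (I.word I.K ⟨t, ht⟩) x)
    (hx : ∀ i : Fin I.n, s.N 1 (i * I.n + s.N 20 i) = x i) :
    Runs (emit ;; update) s (I.n * 360 + 80) (Progress I (t + 1) (L ++ [⟨t, ht⟩])) := by
  refine Runs.le ((runs_emit hT hw).seq fun s₁ hk₁ ⟨h24, h4, hold, hnew⟩ =>
    (runs_update (hT.of_keeps hk₁) (x := x) fun i => by
      rw [hk₁.1 1 (by decide), hk₁.1 20 (by decide), hx]).imp fun s₂ hk₂ ⟨hc, hb⟩ => ?_) (by omega)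
  have hval : I.value x = wordValue (I.word I.K ⟨t, ht⟩) := value_eq_of_isTop htop
  have hc₁ : s₁.N 4 0 = L.length := by rw [hk₁.1 4 (by decide), h.count]
  have h5 : s₁.Q 5 0 = s.Q 5 0 := by rw [hk₁.2 5 (by decide)]
  have h3 : s₁.N 3 = s.N 3 := hk₁.1 3 (by decide)
  refine ⟨?_, fun u => ?_, ?_, ?_, fun j u hu p => ?_, fun _ => ?_⟩
  · refine List.nodup_append.2 ⟨h.nodup, List.nodup_singleton _, fun a ha b hb => ?_⟩
    rw [List.mem_singleton.1 hb]
    rintro rfl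
    exact ((h.mem_iff _).1 ha).1.false
  · rw [List.mem_append, h.mem_iff, List.mem_singleton, Fin.ext_iff]
    constructor
    · rintro (⟨hu, hf⟩ | hu)
      · exact ⟨by omega, hf⟩
      · obtain rfl : u = ⟨t, ht⟩ := Fin.ext hu
        exact ⟨by simp, x, hst, htop⟩
    · rintro ⟨hu, hf⟩
      rcases Nat.lt_succ_iff_lt_or_eq.1 hu with hu | hu
      · exact .inl ⟨hu, hf⟩
      · exact .inr hu
  · rw [hc, hc₁]
    simp
  · rw [hk₂.1 24 (by decide), h24, h.free]
    simp [add_mul]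
  · rw [hk₂.2 3 (by decide), hk₂.1 5 (by decide), hk₂.1 6 (by decide)]
    rcases lt_or_ge j L.length with hj | hj
    · rw [List.getElem?_append_left hj] at hu
      have hlt : j * I.K + p < s.N 24 0 := by
        have := Nat.mul_le_mul_right I.K (Nat.succ_le_of_lt hj)
        rw [h.free]
        rw [Nat.succ_mul] at this
        have := p.is_lt
        omega
      obtain ⟨e₁, e₂, e₃⟩ := hold _ hlt
      rw [e₁, e₂, e₃]
      exact h.out j u hu p
    · obtain ⟨hj', -⟩ := List.getElem?_eq_some_iff.1 hu
      obtain rfl : j = L.length := by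
        rw [List.length_append, List.length_singleton] at hj'
        omega
      rw [List.getElem?_concat_length, Option.some_inj] at hu
      subst hu
      rw [← h.free]
      exact hnew p
  · rw [h4, hc₁, h5, h3] at hb
    rw [List.forall_mem_append]
    simp only [List.forall_mem_singleton]
    rcases hb with ⟨hL, hle, hb, hb'⟩ | ⟨hle, hb, hb'⟩
    · obtain ⟨y, hy, hvy, hN, hmin⟩ := h.best (by rintro rfl; simp at hL)
      rw [hb, hb']
      exact ⟨y, hy, hvy, hN, hmin, hle⟩
    · refine ⟨x, hst, by rw [hb, hval], hb', fun u hu => ?_, hb.le⟩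
      have hne : L ≠ [] := List.ne_nil_of_mem hu
      obtain ⟨y, hy, hvy, hN, hmin⟩ := h.best hne
      rw [hb]
      exact (hle (by simpa using hne)).trans (hmin u hu)

theorem runs_treatWord (h : Progress I t L s) (ht : t < ((I.n + I.n) * I.n) ^ I.K)
    (hT : Tables I s)
    (hdig : ∀ p < I.K, s.N 16 p = t / ((I.n + I.n) * I.n) ^ p % ((I.n + I.n) * I.n)) :
    Runs treatWord s (I.n ^ 4 * 3000) fun s' => ∃ L', Progress I (t + 1) L' s' ∧
      (∀ p < I.K, s'.N 16 p = (t + 1) / ((I.n + I.n) * I.n) ^ p % ((I.n + I.n) * I.n)) ∧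
      ((s'.N 25 0 = 1 ∧ t + 1 = ((I.n + I.n) * I.n) ^ I.K) ∨
        (s'.N 25 0 = 0 ∧ t + 1 < ((I.n + I.n) * I.n) ^ I.K)) := by
  have hw : HasWord (I.word I.K ⟨t, ht⟩) s := fun p => by
    rw [word_fst, word_snd, Nat.div_add_mod', hdig p p.is_lt]
  let T₁ := (I.n * I.n + 2) * (I.n * (I.n * 60 + 180) + 40) + I.n * 80 + 60
  refine Runs.le (Runs.seq (T₂ := (4 + (T₁ + (4 + (I.n * 360 + 80) + 1)) + 1) + (I.n * 150 + 20))
    (runs_readWord hT hw) fun s₁ hk₁ ⟨hgood, hbounds⟩ => ?_) ?_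
  · have hT₁ := hT.of_keeps hk₁
    have h₁ := h.of_keeps hk₁
    have hw₁ : HasWord (I.word I.K ⟨t, ht⟩) s₁ := fun p => by rw [hk₁.1 16 (by decide), hw p]
    refine Runs.seq (R := fun s' => ∃ L', Progress I (t + 1) L' s')
      (Runs.ite (T := T₁ + (4 + (I.n * 360 + 80) + 1)) (fun hc => ?_) fun hc => ?_)
      fun s₂ hk₂ ⟨L', h₂⟩ => ?_
    · have h19 : 1 ≤ s₁.N 19 0 := (BExp.leN_iff _ _ _).1 hc
      have hb := hbounds h19
      obtain ⟨hinj, hanti⟩ := hgood.1 h19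
      refine (runs_propose hT₁ h19).seq fun s₂ hk₂ h₂ => ?_
      have hT₂ := hT₁.of_keeps hk₂
      have hp₂ := h₁.of_keeps hk₂
      have hw₂ : HasWord (I.word I.K ⟨t, ht⟩) s₂ := fun p => by rw [hk₂.1 16 (by decide), hw₁ p]
      refine Runs.ite (T := I.n * 360 + 80) (fun hc₂ => ?_) fun hc₂ => ?_
      · simp only [BExp.leN_iff, NExp.eval, NExp.eval_var] at hc₂
        rcases h₂ with ⟨-, x, hst, hA, hx⟩ | ⟨h0, -⟩
        · exact (runs_emit_update hp₂ ht hT₂ hw₂ hst ((hb.isTop_iff hinj hanti).2 hA) hx).imp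
            fun s' _ h => ⟨_, h⟩
        · omega
      · simp only [BExp.leN_iff, NExp.eval, NExp.eval_var] at hc₂
        rcases h₂ with ⟨h0, -⟩ | ⟨-, hno⟩
        · omega
        · refine Runs.of_sem (I.n * 360 + 80) ⟨L, hp₂.skip ht ?_⟩ (by decide)
            (show 1 ≤ I.n * 360 + 80 by omega)
          rintro ⟨x, hst, htop⟩
          exact hno ⟨x, hst, (hb.isTop_iff hinj hanti).1 htop⟩
    · refine Runs.of_sem (T₁ + (4 + (I.n * 360 + 80) + 1)) ⟨L, h₁.skip ht ?_⟩ (by decide)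
        (show 1 ≤ T₁ + (4 + (I.n * 360 + 80) + 1) by omega)
      rintro ⟨x, hst, htop⟩
      have := hgood.2 ⟨htop.inj, htop.anti⟩
      simp [NExp.eval] at hc
      omega
    · refine (runs_nextWord (t := t) ((hT₁.of_keeps hk₂)) fun p hp => ?_).imp
        fun s₃ hk₃ ⟨hd, hc⟩ => ⟨L', h₂.of_keeps hk₃, hd, hc.imp (fun ⟨hc, hdvd⟩ => ⟨hc, ?_⟩)
          fun ⟨hc, hdvd⟩ => ⟨hc, lt_of_le_of_ne ht fun h => hdvd (h ▸ dvd_rfl)⟩⟩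
      · rw [hk₂.1 16 (by decide), hk₁.1 16 (by decide), hdig p hp]
      · exact le_antisymm ht (Nat.le_of_dvd (Nat.succ_pos _) hdvd)
  · have h₁ := I.n_pos
    have h₂ : I.n ≤ I.n ^ 4 := Nat.le_self_pow (by norm_num) _
    have h₃ : I.n ^ 2 ≤ I.n ^ 4 := Nat.pow_le_pow_right h₁ (by norm_num)
    have h₄ : I.n ^ 3 ≤ I.n ^ 4 := Nat.pow_le_pow_right h₁ (by norm_num)
    -- The leading term comes from `n ^ 2` rounds of `n` proposals, each compared with `n` rivals.
    have e : T₁ = I.n ^ 4 * 60 + I.n ^ 3 * 180 + I.n ^ 2 * 160 + I.n * 440 + 140 := by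
      simp only [T₁]
      ring
    omega

end Progress

/-! ## The algorithm -/

/-- The memory holds the output of the algorithm for an instance and the bound `B`. -/
def Solved (I : Instance) (B : ℚ) (s : State) : Prop :=
  optimization.Correct I s ∧ enumeration.Correct I s ∧ decision.Correct (I, B) s

/-- Every stable marriage has a top word, which is in `L` with the same value. So the minimum over
`L` is the optimum, and comparing it with `B` decides the threshold question. A stable marriage
exists, hence `L` is nonempty and a best marriage is stored. -/
theorem Progress.solved {L : List (Fin (((I.n + I.n) * I.n) ^ I.K))} {B : ℚ}
    (h : Progress I (((I.n + I.n) * I.n) ^ I.K) L s)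
    (h7 : s.N 7 0 = if s.Q 5 0 ≤ B then 1 else 0) : Solved I B s := by
  have hword (y : I.Marriage) (hy : I.IsStable y) :
      ∃ u ∈ L, I.value y = wordValue (I.word I.K u) := by
    obtain ⟨w, hw⟩ := exists_isTop I.K_le y
    refine ⟨(I.word I.K).symm w, (h.mem_iff _).2 ⟨Fin.is_lt _, y, hy, ?_⟩, ?_⟩
    · rwa [Equiv.apply_symm_apply]
    · rw [Equiv.apply_symm_apply]
      exact value_eq_of_isTop hw
  obtain ⟨y, hy⟩ := I.exists_isStable
  obtain ⟨u, hu, -⟩ := hword y hy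
  obtain ⟨x, hx, hval, hN, hmin⟩ := h.best (List.ne_nil_of_mem hu)
  have hopt (y : I.Marriage) (hy : I.IsStable y) : I.value x ≤ I.value y := by
    obtain ⟨u, hu, hv⟩ := hword y hy
    rw [hv, ← hval]
    exact hmin u hu
  refine ⟨⟨x, ⟨hx, hopt⟩, hN⟩, ⟨L.map fun u => I.vec (I.word I.K u), ?_, fun v => ?_, ?_, ?_⟩,
    ?_, ?_⟩
  · exact h.nodup.map (vec_injective.comp (I.word I.K).injective)
  · rw [List.mem_map]
    constructor
    · rintro ⟨u, hu, rfl⟩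
      exact (vec_mem_topPrefixes_iff I.K_le).2 ((h.mem_iff u).1 hu).2
    · intro hv
      obtain ⟨y, σ, -, -, rfl⟩ := id hv
      obtain ⟨w, hw⟩ := exists_vec_eq_take I.K_le y σ
      rw [← hw] at hv ⊢
      refine ⟨(I.word I.K).symm w, (h.mem_iff _).2 ⟨Fin.is_lt _, ?_⟩, ?_⟩
      · rw [Feasible, Equiv.apply_symm_apply]
        exact (vec_mem_topPrefixes_iff I.K_le).1 hv
      · rw [Equiv.apply_symm_apply]
  · rw [h.count, List.length_map]
  · intro j v hj p τ hp
    rw [List.getElem?_map, Option.map_eq_some_iff] at hj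
    obtain ⟨u, hu, rfl⟩ := hj
    rw [vec, List.getElem?_ofFn] at hp
    split_ifs at hp with hpK
    · rw [Option.some_inj] at hp
      subst hp
      exact h.out j u hu ⟨p, hpK⟩
  · rintro ⟨y, hy, hB⟩
    rw [h7, if_pos]
    rw [hval]
    exact (hopt y hy).trans hB
  · intro hno
    rw [h7, if_neg]
    rw [hval]
    exact fun hB => hno ⟨x, hx, hB⟩

theorem runs_program (I : Instance) (extra : List (List ℚ)) :
    Runs program (I.encode extra).state (4000 * (2 ^ I.K * I.n ^ (2 * I.K + 4)))
      (Solved I ((extra.getD 0 []).getD 0 0)) := by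
  set s := (I.encode extra).state with hs
  have hB : 0 < ((I.n + I.n) * I.n) ^ I.K :=
    Nat.pow_pos (Nat.mul_pos (by have := I.n_pos; omega) I.n_pos)
  have hpow : ((I.n + I.n) * I.n) ^ I.K * I.n ^ 4 = 2 ^ I.K * I.n ^ (2 * I.K + 4) := by
    rw [← two_mul, mul_assoc, ← sq, mul_pow, ← pow_mul, mul_assoc, ← pow_add]
  rw [← hpow]
  refine Runs.le (Runs.seq (T₂ := (((I.n + I.n) * I.n) ^ I.K * (4 + I.n ^ 4 * 3000 + 1) + (4 + 1)) +
    30) (runs_setup I extra) fun s₁ hk₁ hT => ?_) ?_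
  -- Fresh cells are `0`, and this is the right start: word number `0`, empty output, loop flag `25`
  -- down.
  · have e (a : ℕ) (ha : setup.writesN a = false) (ha₃ : 3 ≤ a) (i : ℕ) : s₁.N a i = 0 := by
      rw [hk₁.1 a ha]
      show (List.getD _ a []).getD i 0 = 0
      rw [List.getD_eq_default _ [] (by simpa [Instance.encode] using ha₃)]
      simp
    refine Runs.seq (R := fun s' => s'.Q 2 = s₁.Q 2 ∧ s'.N 7 0 = 0 ∧
      ∃ L, Progress I (((I.n + I.n) * I.n) ^ I.K) L s') (Runs.whileLoop (T := I.n ^ 4 * 3000)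
      (fun k s' => Keeps treatWord s₁ s' ∧ ∃ t L, Progress I t L s' ∧
        ((s'.N 25 0 = 0 ∧ t < ((I.n + I.n) * I.n) ^ I.K ∧ k = ((I.n + I.n) * I.n) ^ I.K - t ∧
          ∀ p < I.K, s'.N 16 p = t / ((I.n + I.n) * I.n) ^ p % ((I.n + I.n) * I.n)) ∨
        (s'.N 25 0 = 1 ∧ t = ((I.n + I.n) * I.n) ^ I.K ∧ k = 0)))
      (fun k s₂ h₂ => ?_) (((I.n + I.n) * I.n) ^ I.K) s₁ ?_) fun s₂ hk₂ ⟨hQ2, h7, L, h₂⟩ => ?_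
    · obtain ⟨hk₂, t, L, hp, ⟨h25, ht, hk, hdig⟩ | ⟨h25, rfl, -⟩⟩ := h₂
      · right
        refine ⟨by simp [NExp.eval, h25], ?_⟩
        refine (runs_treatWord hp ht (hT.of_keeps hk₂) hdig).imp
          fun s₃ hk₃ ⟨L', hp', hd, hc⟩ => ?_
        rcases hc with ⟨hc, htB⟩ | ⟨hc, htB⟩
        · exact ⟨0, by omega, hk₂.trans hk₃, _, L', hp', .inr ⟨hc, htB, rfl⟩⟩
        · exact ⟨_, by omega, hk₂.trans hk₃, _, L', hp', .inl ⟨hc, htB, rfl, hd⟩⟩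
      · left
        refine ⟨by simp [NExp.eval, h25], hk₂.2 2 (by decide), ?_, L, hp⟩
        rw [hk₂.1 7 (by decide), e 7 (by decide) (by norm_num)]
    · refine ⟨.refl _ _, 0, [], ⟨List.nodup_nil, by simp, ?_, ?_, by simp, by simp⟩, .inl ?_⟩
      · simp [e 4 (by decide) (by norm_num)]
      · simp [e 24 (by decide) (by norm_num)]
      · exact ⟨e 25 (by decide) (by norm_num) 0, hB, rfl, fun p _ => by
          simp [e 16 (by decide) (by norm_num)]⟩
    · refine (Runs.of_sem 30 (Q := fun s' =>
        s'.N 7 0 = if s'.Q 5 0 ≤ (extra.getD 0 []).getD 0 0 then 1 else 0) ?_).imp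
        fun s₃ hk₃ h => (h₂.of_keeps hk₃).solved h
      -- Without a bound in the input the machine compares with `0`, which is harmless for the other
      -- two problems.
      have hQ : s₂.Q 2 0 = (extra.getD 0 []).getD 0 0 := by
        rw [hQ2, hk₁.2 2 (by decide)]
        cases extra <;> rfl
      simp only [sem, BExp.leQ_iff, QExp.eval, NExp.eval, hQ]
      split_ifs <;> simp_all
  · have h₁ : 1 ≤ I.n ^ 4 := Nat.one_le_pow _ _ I.n_pos
    generalize I.n ^ 4 = m at *
    generalize ((I.n + I.n) * I.n) ^ I.K = M at *
    have h₂ : m ≤ M * m := Nat.le_mul_of_pos_left _ hB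
    have h₃ : M ≤ M * m := Nat.le_mul_of_pos_right _ h₁
    nlinarith

/-! ### From operations to bits: the XP bound -/

theorem Instance.n_le_size_encode (I : Instance) (extra : List (List ℚ)) :
    I.n ≤ (I.encode extra).size := by
  have : I.n ≤ (((I.encode extra).rats.map fun l => (l.map fun q => ratSize q + 1).sum)).sum := by
    simp only [Instance.encode, List.map_cons, List.sum_cons]
    refine le_trans ?_ (Nat.le_add_right _ _)
    refine le_trans ?_ (List.length_le_sum_of_one_le _ fun i hi => ?_)
    · simp
    · obtain ⟨q, -, rfl⟩ := List.mem_map.1 hi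
      omega
  rw [Input.size]
  omega

theorem computable_const_mul_pow (a b : ℕ) : Computable fun k : ℕ => a * b ^ k := by
  have hpow : Primrec₂ fun x y : ℕ => x ^ y := Primrec₂.unpaired'.1 Nat.Primrec.pow
  exact (Primrec.nat_mul.comp (Primrec.const a)
    (hpow.comp (Primrec.const b) Primrec.id)).to_comp

theorem computable_mul_add (a b : ℕ) : Computable fun k : ℕ => a * k + b :=
  (Primrec.nat_add.comp (Primrec.nat_mul.comp (Primrec.const a) Primrec.id)
    (Primrec.const b)).to_comp

/-- With `X = 2 ^ K * S ^ (2K + 4)`, the factors are at most `4000 * X` and `5000 * (X * S)`; the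
exponent is `2 * (2K + 4) + 1`. -/
theorem bits_le {b t S n K : ℕ} (hb : b ≤ t * (4 * S + t + 4)) (hn : 0 < n) (hS : n ≤ S)
    (ht : t ≤ 4000 * (2 ^ K * n ^ (2 * K + 4))) :
    b ≤ 20000000 * 4 ^ K * S ^ (4 * K + 9) := by
  set X := 2 ^ K * S ^ (2 * K + 4) with hX
  have hSpos : 1 ≤ S := by omega
  have hXpos : 1 ≤ X := Nat.mul_pos (by positivity) (by positivity)
  have ht' : t ≤ 4000 * X := ht.trans
    (Nat.mul_le_mul_left _ (Nat.mul_le_mul_left _ (Nat.pow_le_pow_left hS _)))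
  have hXX : X * X * S = 4 ^ K * S ^ (4 * K + 9) := by
    rw [hX, show (4 : ℕ) = 2 * 2 from rfl, mul_pow]
    ring
  have h₁ : 4 * S + t + 4 ≤ 5000 * (X * S) := by
    have : X ≤ X * S := Nat.le_mul_of_pos_right _ hSpos
    have : S ≤ X * S := Nat.le_mul_of_pos_left _ hXpos
    omega
  calc b ≤ t * (4 * S + t + 4) := hb
    _ ≤ 4000 * X * (5000 * (X * S)) := Nat.mul_le_mul ht' h₁
    _ = 20000000 * 4 ^ K * S ^ (4 * K + 9) := by
      rw [mul_assoc 20000000, ← hXX]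
      ring

end GGISM

theorem mainTheorem3 :
    GGISM.optimization.SolvableInTime
      (fun I : GGISM.Instance => 2 ^ I.K * I.n ^ (2 * I.K + 4)) ∧
    GGISM.enumeration.SolvableInTime
      (fun I : GGISM.Instance => 2 ^ I.K * I.n ^ (2 * I.K + 4)) ∧
    GGISM.optimization.InXP ∧
    GGISM.decision.InXP := by
  -- One program solves all problems; the XP bound has `f k = 20000000 * 4 ^ k` and `g k = 4 * k +
  -- 9`.
  refine ⟨⟨GGISM.program, 4000, fun I => ?_⟩, ⟨GGISM.program, 4000, fun I => ?_⟩,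
    ⟨GGISM.program, _, _, GGISM.computable_const_mul_pow 20000000 4,
      GGISM.computable_mul_add 4 9, fun I => ?_⟩,
    ⟨GGISM.program, _, _, GGISM.computable_const_mul_pow 20000000 4,
      GGISM.computable_mul_add 4 9, fun J => ?_⟩⟩
  · obtain ⟨s, t, b, he, ht, h⟩ := GGISM.runs_program I []
    exact ⟨s, t, b, he, h.1, ht⟩
  · obtain ⟨s, t, b, he, ht, h⟩ := GGISM.runs_program I []
    exact ⟨s, t, b, he, h.2.1, ht⟩
  · obtain ⟨s, t, b, he, ht, h⟩ := GGISM.runs_program I []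
    exact ⟨s, t, b, he, h.1, GGISM.bits_le (he.bits_le_of_input GGISM.program_tame) I.n_pos
      (I.n_le_size_encode _) ht⟩
  · obtain ⟨s, t, b, he, ht, h⟩ := GGISM.runs_program J.1 [[J.2]]
    exact ⟨s, t, b, he, h.2.2, GGISM.bits_le (he.bits_le_of_input GGISM.program_tame) J.1.n_pos
      (J.1.n_le_size_encode _) ht⟩
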